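/- Let $d\in\mathbf N$, $s>1$, $\phi(x)=\pi^{-d/4}e^{-|x|^2/2}$ on $\mathbf R^d$, and let $f\in\mathcal S_{1/2}'(\mathbf R^d)$, the topological dual of the Gelfand–Shilov space $\mathcal S_{1/2}(\mathbf R^d)$ of all smooth $g$ such that, for some $C,h>0$, $|x|^{k}\,\|D^ng(x)\|\le C h^{k+n}(k!\,n!)^{1/2}$ for all $k,n\in\mathbf N$ and $x\in\mathbf R^d$. Let $V_\phi g(x,\xi)=\int_{\mathbf R^d} g(t)\overline{\phi(t-x)}e^{-i\langle t,\xi\rangle}\,dt$ be the short-time Fourier transform, and let $V_\phi^*$ be its adjoint: $f=V_\phi^*F$ means that $(f,g)=(F,V_\phi g)$ for every $g\in\mathcal S_{1/2}(\mathbf R^d)$, where $(u,v)=\langle u,\overline v\rangle$. For $r\in\mathbf R_+^d$ let $\overline{D_r(0)}=\{z\in\mathbf C^d : |z_j|\le r_j,\ j=1,\dots,d\}$ and let $\chi_r$ be its characteristic function, $\mathbf C^d\simeq\mathbf R^{2d}$ through $x+i\xi\leftrightarrow(x,\xi)$. Let $\mathcal E_s'(\mathbf R^{2d})$ be the space of compactly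 supported Gevrey distributions of order $s$, that is, the dual of the space $\mathcal E_s(\mathbf R^{2d})$ of smooth functions $\psi$ such that for every compact $K$ there are $C,h>0$ with $\|D^n\psi\|\le Ch^n(n!)^s$ on $K$ for all $n$. Let $h_\alpha(x)=\pi^{-d/4}(-1)^{|\alpha|}(2^{|\alpha|}\alpha!)^{-1/2}e^{|x|^2/2}\partial^\alpha e^{-|x|^2}$, $\alpha\in\mathbf N^d$, be the Hermite functions, and let the Pilipović space $\mathcal H_{\flat_1}(\mathbf R^d)$ consist of all $f\in L^2(\mathbf R^d)$ for which there are $r\in\mathbf R_+^d$ and $C>0$ with $|(f,h_\alpha)_{L^2}|\le C r^\alpha\alpha!^{-1/2}$ for all $\alpha\in\mathbf N^d$. Then the following conditions are equivalent: (1) $f\in\mathcal H_{\flat_1}(\mathbf R^d)$; (2) $f=V_\phi^*F$ for some $F\in\mathcal E_s'(\mathbf R^{2d})$; (3) $f=V_\phi^*F$ for some compactly supported $F\in L^\infty(\mathbf R^{2d})$ (that is, $f$ belongs to Gröchenig's test function space $\mathcal S_C(\mathbf R^d)$); (4) $f=V_\phi^*F$ for some compactly supported $F\in L^\infty(\mathbf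 R^{2d})$ of the form $F(x,\xi)=F_0(x-i\xi)e^{-i\langle x,\xi\rangle}\chi_r(x,\xi)$, for some $r\in\mathbf R_+^d$ and some $F_0$ analytic in a neighbourhood of $\overline{D_r(0)}$. -/

import Mathlib

open MeasureTheory
open scoped ContDiff ComplexConjugate Nat

/-- The space `ℝ^d` with its Euclidean norm and Lebesgue measure. Phase space `ℝ^{2d}` is
`RSp d × RSp d`, with points `(x, ξ)` and the product (Lebesgue) measure. -/
abbrev RSp (d : ℕ) : Type := EuclideanSpace ℝ (Fin d)

/-! ### Gevrey functions and compactly supported Gevrey distributions -/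

section Gevrey

variable {E : Type*} [NormedAddCommGroup E] [NormedSpace ℝ E]

/-- `‖D^n f(x)‖ ≤ M h^n (n!)^s` for all `n` and all `x ∈ K`. -/
def GevreyBoundOn (s : ℝ) (K : Set E) (h M : ℝ) (f : E → ℂ) : Prop :=
  ∀ (n : ℕ), ∀ x ∈ K, ‖iteratedFDeriv ℝ n f x‖ ≤ M * h ^ n * (n ! : ℝ) ^ s

/-- `f` is smooth and of (Roumieu) Gevrey regularity `s`: on each compact set,
`‖D^n f‖ ≤ M h^n (n!)^s` for some `h` and `M`. -/
def IsGevrey (s : ℝ) (f : E → ℂ) : Prop :=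
  ContDiff ℝ ∞ f ∧
    ∀ K : Set E, IsCompact K → ∃ h M : ℝ, 0 < h ∧ 0 ≤ M ∧ GevreyBoundOn s K h M f

/-- `‖x‖^k ‖D^n f(x)‖ ≤ M h^{k+n} (k! n!)^s` for all `k`, `n` and `x`. -/
def GelfandShilovBound (s h M : ℝ) (f : E → ℂ) : Prop :=
  ∀ (k n : ℕ) (x : E),
    ‖x‖ ^ k * ‖iteratedFDeriv ℝ n f x‖ ≤ M * h ^ (k + n) * ((k ! : ℝ) * (n ! : ℝ)) ^ s

/-- `f` belongs to the Fourier invariant Gelfand–Shilov space `𝓢_s` (Roumieu type). -/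
def IsGelfandShilov (s : ℝ) (f : E → ℂ) : Prop :=
  ContDiff ℝ ∞ f ∧ ∃ h M : ℝ, 0 < h ∧ 0 ≤ M ∧ GelfandShilovBound s h M f

theorem norm_iteratedFDeriv_add_le_of_smooth {f g : E → ℂ} (hf : ContDiff ℝ ∞ f)
    (hg : ContDiff ℝ ∞ g) (n : ℕ) (x : E) :
    ‖iteratedFDeriv ℝ n (f + g) x‖ ≤
      ‖iteratedFDeriv ℝ n f x‖ + ‖iteratedFDeriv ℝ n g x‖ := by
  rw [iteratedFDeriv_add_apply (hf.contDiffAt.of_le (by exact_mod_cast le_top))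
    (hg.contDiffAt.of_le (by exact_mod_cast le_top))]
  exact norm_add_le _ _

theorem norm_iteratedFDeriv_smul_of_smooth {f : E → ℂ} (hf : ContDiff ℝ ∞ f)
    (c : ℂ) (n : ℕ) (x : E) :
    ‖iteratedFDeriv ℝ n (c • f) x‖ = ‖c‖ * ‖iteratedFDeriv ℝ n f x‖ := by
  rw [iteratedFDeriv_const_smul_apply (hf.contDiffAt.of_le (by exact_mod_cast le_top)),
    norm_smul]

/-- The space `𝓔_s(E)` of Gevrey functions of order `s`. -/
def gevreySpace (s : ℝ) (E : Type*) [NormedAddCommGroup E] [NormedSpace ℝ E] :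
    Submodule ℂ (E → ℂ) where
  carrier := {f | IsGevrey s f}
  zero_mem' := by
    refine ⟨contDiff_const, fun K _ => ⟨1, 0, one_pos, le_rfl, fun n x _ => ?_⟩⟩
    simp
  add_mem' := by
    rintro f g ⟨hf, hf'⟩ ⟨hg, hg'⟩
    refine ⟨hf.add hg, fun K hK => ?_⟩
    obtain ⟨h₁, M₁, hh₁, hM₁, b₁⟩ := hf' K hK
    obtain ⟨h₂, M₂, hh₂, hM₂, b₂⟩ := hg' K hK
    refine ⟨max h₁ h₂, M₁ + M₂, lt_max_of_lt_left hh₁, by positivity, fun n x hx => ?_⟩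
    refine (norm_iteratedFDeriv_add_le_of_smooth hf hg n x).trans ?_
    refine (add_le_add (b₁ n x hx) (b₂ n x hx)).trans ?_
    rw [add_mul, add_mul]
    gcongr
    · exact le_max_left _ _
    · exact le_max_right _ _
  smul_mem' := by
    rintro c f ⟨hf, hf'⟩
    refine ⟨contDiff_const.smul hf, fun K hK => ?_⟩
    obtain ⟨h₁, M₁, hh₁, hM₁, b₁⟩ := hf' K hK
    refine ⟨h₁, ‖c‖ * M₁, hh₁, by positivity, fun n x hx => ?_⟩
    rw [norm_iteratedFDeriv_smul_of_smooth hf, mul_assoc, mul_assoc]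
    rw [← mul_assoc M₁]
    gcongr
    exact b₁ n x hx

/-- The space `𝓔_s'(E)` of compactly supported Gevrey distributions of order `s`: the
topological dual of `𝓔_s(E)`. As `𝓔_s(E)` is the projective limit over compact `K`, and for each
`K` the inductive limit over `h > 0`, of the spaces normed by
`sup_{n, x ∈ K} ‖D^n f(x)‖ / (h^n (n!)^s)`, a linear form is continuous when, for some `K`, it is
bounded with respect to each of these norms. -/
def gevreyDual (s : ℝ) (E : Type*) [NormedAddCommGroup E] [NormedSpace ℝ E] :
    Set (Module.Dual ℂ (gevreySpace s E)) :=
  {F | ∃ K : Set E, IsCompact K ∧ ∀ h : ℝ, 0 < h → ∃ C : ℝ,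
    ∀ (f : gevreySpace s E) (M : ℝ), 0 ≤ M → GevreyBoundOn s K h M (f : E → ℂ) →
      ‖F f‖ ≤ C * M}

/-- The Gelfand–Shilov space `𝓢_s(E)`. -/
def gelfandShilov (s : ℝ) (E : Type*) [NormedAddCommGroup E] [NormedSpace ℝ E] :
    Submodule ℂ (E → ℂ) where
  carrier := {f | IsGelfandShilov s f}
  zero_mem' := by
    refine ⟨contDiff_const, 1, 0, one_pos, le_rfl, fun k n x => ?_⟩
    simp
  add_mem' := by
    rintro f g ⟨hf, h₁, M₁, hh₁, hM₁, b₁⟩ ⟨hg, h₂, M₂, hh₂, hM₂, b₂⟩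
    refine ⟨hf.add hg, max h₁ h₂, M₁ + M₂, lt_max_of_lt_left hh₁, by positivity,
      fun k n x => ?_⟩
    refine (mul_le_mul_of_nonneg_left (norm_iteratedFDeriv_add_le_of_smooth hf hg n x)
      (by positivity)).trans ?_
    rw [mul_add]
    refine (add_le_add (b₁ k n x) (b₂ k n x)).trans ?_
    rw [add_mul, add_mul]
    gcongr
    · exact le_max_left _ _
    · exact le_max_right _ _
  smul_mem' := by
    rintro c f ⟨hf, h₁, M₁, hh₁, hM₁, b₁⟩
    refine ⟨contDiff_const.smul hf, h₁, ‖c‖ * M₁, hh₁, by positivity, fun k n x => ?_⟩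
    rw [norm_iteratedFDeriv_smul_of_smooth hf, mul_left_comm, mul_assoc ‖c‖, mul_assoc ‖c‖]
    exact mul_le_mul_of_nonneg_left (b₁ k n x) (norm_nonneg c)

/-- The topological dual `𝓢_s'(E)`: as `𝓢_s(E)` is the inductive limit over `h > 0` of the
spaces normed by `sup ‖x‖^k ‖D^n f(x)‖ / (h^{k+n} (k! n!)^s)`, a linear form is continuous
when it is bounded with respect to each of these norms. -/
def gelfandShilovDual (s : ℝ) (E : Type*) [NormedAddCommGroup E] [NormedSpace ℝ E] :
    Set (Module.Dual ℂ (gelfandShilov s E)) :=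
  {u | ∀ h : ℝ, 0 < h → ∃ C : ℝ, ∀ (f : gelfandShilov s E) (M : ℝ), 0 ≤ M →
    GelfandShilovBound s h M (f : E → ℂ) → ‖u f‖ ≤ C * M}

/-- The complex conjugate of an element of `𝓢_s`. -/
def gelfandShilovConj {s : ℝ} (f : gelfandShilov s E) : gelfandShilov s E :=
  ⟨fun x => conj ((f : E → ℂ) x), by
    obtain ⟨hf, h₁, M₁, hh₁, hM₁, b₁⟩ := f.2
    refine ⟨Complex.conjLIE.contDiff.comp hf, h₁, M₁, hh₁, hM₁, fun k n x => ?_⟩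
    have := Complex.conjLIE.norm_iteratedFDeriv_comp_left (f : E → ℂ) x n
    have e : (fun x => conj ((f : E → ℂ) x)) = Complex.conjLIE ∘ (f : E → ℂ) := rfl
    rw [e, this]
    exact b₁ k n x⟩

end Gevrey

noncomputable section

/-! ### The short-time Fourier transform with Gaussian window and its adjoint -/

/-- The window `φ(x) = π^{-d/4} e^{-|x|²/2}`. -/
def gaussianWindow (d : ℕ) (x : RSp d) : ℂ :=
  ((Real.pi ^ (-(d : ℝ) / 4) * Real.exp (-‖x‖ ^ 2 / 2) : ℝ) : ℂ)

/-- The short-time Fourier transform with window `φ = w`,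
`V_φ f(x, ξ) = ∫ f(t) conj(φ(t - x)) e^{-i⟨t, ξ⟩} dt`. -/
def stft {d : ℕ} (w f : RSp d → ℂ) (p : RSp d × RSp d) : ℂ :=
  ∫ t : RSp d, f t * conj (w (t - p.1)) * Complex.exp (-Complex.I * (inner ℝ t p.2 : ℝ))

/-- `f = V_φ^* F`, `φ = w`, for a Gevrey distribution `F` on `ℝ^{2d}` and `f ∈ 𝓢_{1/2}'(ℝ^d)`: for all
`g ∈ 𝓢_{1/2}(ℝ^d)` one has `(f, g) = (F, V_φ g)`, where `(u, v) = ⟨u, conj v⟩`. Here `conj (V_φ g)`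
has to be an element of `𝓔_s`. -/
def IsStftAdjoint {d : ℕ} {s : ℝ} (w : RSp d → ℂ)
    (F : Module.Dual ℂ (gevreySpace s (RSp d × RSp d)))
    (f : Module.Dual ℂ (gelfandShilov (1 / 2) (RSp d))) : Prop :=
  ∀ g : gelfandShilov (1 / 2) (RSp d), ∃ G : gevreySpace s (RSp d × RSp d),
    (∀ p, (G : RSp d × RSp d → ℂ) p = conj (stft w (g : RSp d → ℂ) p)) ∧
      f (gelfandShilovConj g) = F G

/-- `f = V_φ^* F`, `φ = w`, for a function `F` on `ℝ^{2d}`: for all `g ∈ 𝓢_{1/2}(ℝ^d)` one has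
`(f, g) = (F, V_φ g)`, the right hand side being the `L²` pairing. -/
def IsStftAdjointFun {d : ℕ} (w : RSp d → ℂ) (F : RSp d × RSp d → ℂ)
    (f : Module.Dual ℂ (gelfandShilov (1 / 2) (RSp d))) : Prop :=
  ∀ g : gelfandShilov (1 / 2) (RSp d),
    f (gelfandShilovConj g) = ∫ p : RSp d × RSp d, F p * conj (stft w (g : RSp d → ℂ) p)

/-- `F ∈ L^∞ ∩ 𝓔'`. -/
def IsBoundedCompactlySupported {d : ℕ} (F : RSp d × RSp d → ℂ) : Prop :=
  MemLp F ⊤ volume ∧ HasCompactSupport F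

/-! ### Hermite functions and the Pilipović spaces -/

/-- The Hermite function `h_α(x) = π^{-d/4} (-1)^{|α|} (2^{|α|} α!)^{-1/2} e^{|x|²/2}
(∂^α e^{-|x|²})`, where `∂^α e^{-|x|²}` is written as the product of the `(d/dx_j)^{α_j} e^{-x_j²}`. -/
def hermiteFun {d : ℕ} (α : Fin d → ℕ) (x : RSp d) : ℝ :=
  Real.pi ^ (-(d : ℝ) / 4) * (-1) ^ (∑ j, α j) *
    ((2 : ℝ) ^ (∑ j, α j) * ∏ j, ((α j)! : ℝ)) ^ (-(1 / 2) : ℝ) *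
    Real.exp (‖x‖ ^ 2 / 2) *
    ∏ j, iteratedDeriv (α j) (fun t : ℝ => Real.exp (-t ^ 2)) (x j)

/-- The Hermite coefficient `c_h(f, α) = (f, h_α)_{L²}` (the Hermite functions are real). -/
def hermiteCoeff {d : ℕ} (f : RSp d → ℂ) (α : Fin d → ℕ) : ℂ :=
  ∫ x : RSp d, f x * (hermiteFun α x : ℂ)

/-- `f ∈ 𝓗_{♭_σ}(ℝ^d)`: `f ∈ L²` and, for some `r ∈ ℝ_+^d`,
`|c_h(f, α)| ≤ C r^α α!^{-1/(2σ)}`. -/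
def IsPilipovicFlat {d : ℕ} (σ : ℝ) (f : RSp d → ℂ) : Prop :=
  MemLp f 2 volume ∧ ∃ r : Fin d → ℝ, (∀ j, 0 < r j) ∧ ∃ C : ℝ, ∀ α : Fin d → ℕ,
    ‖hermiteCoeff f α‖ ≤ C * ((∏ j, r j ^ α j) * (∏ j, ((α j)! : ℝ)) ^ (-(1 / (2 * σ))))

/-- The distribution `f ∈ 𝓢_{1/2}'(ℝ^d)` is (given by) an element of `𝓗_{♭_σ}(ℝ^d)`. -/
def MemPilipovicFlat {d : ℕ} (σ : ℝ) (f : Module.Dual ℂ (gelfandShilov (1 / 2) (RSp d))) : Prop :=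
  ∃ f₀ : RSp d → ℂ, IsPilipovicFlat σ f₀ ∧
    ∀ g : gelfandShilov (1 / 2) (RSp d), f g = ∫ x : RSp d, f₀ x * (g : RSp d → ℂ) x

/-! ### Polydiscs -/

/-- The closed polydisc with centre `0` and radii `r_j`. -/
def closedPolydisc {d : ℕ} (r : Fin d → ℝ) : Set (Fin d → ℂ) :=
  {z | ∀ j, ‖z j‖ ≤ r j}

/-- The characteristic function `χ_r(x, ξ)` of the closed polydisc, under
`(x, ξ) ↦ x + iξ`. -/
def polydiscChar {d : ℕ} (r : Fin d → ℝ) (p : RSp d × RSp d) : ℂ :=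
  (closedPolydisc r).indicator (fun _ => (1 : ℂ)) (fun j => (p.1 j : ℂ) + Complex.I * (p.2 j : ℂ))

end

/-! With z = x + iξ, the conjugate of V_φ g is e^{-|x|²/2} ∫ e^{t·z} conj(g(t)) φ(t) dt: a Gaussian
in x times an entire function of z. For g = h_α the product h_α φ is a multiple of ∂^α e^{-|t|²}, so
this transform is explicit: κ_α z^α e^{-|x|²/2} e^{z²/4}, where z² = ∑ z_j² and κ_α = (2^{|α|}
α!)^{-1/2} (`laplaceTransform_hermiteWindow`). Since κ_α carries the factor α!^{-1/2}, membership in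
𝓗_{♭_1} says exactly that c_h(f, α) / κ_α grows at most geometrically in |α|.

From (2) to (1): multiplication by one coordinate z_j keeps the rate of derivative bounds on a
compact set and costs only a constant factor (`FactorialBoundOn.clm_mul`). Hence a compactly
supported Gevrey distribution F sends z^α q, with q fixed, to a number of geometric size in |α|.
Applied to the transforms of h_α this bounds the Hermite coefficients. Applied to the expansion of
e^{t·z} in powers of t it shows that F acts on transforms as integration against a function P(t) of
exponential growth (`exists_density_of_mem_gevreyDual`), so f is the L² function Pφ. All estimates
have the form A a^n n!, hence hold in every 𝓔_s with s ≥ 1.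

From (1) to (4): F must satisfy ∫ F z^α e^{-|x|²/2} e^{z²/4} = a_α for a given a of geometric
growth. If F = e^{-z̄²/8} G(z̄) e^{-i⟨x,ξ⟩} on a polydisc, the exponentials collapse to e^{-z²/8}
e^{-|z|²/4} (`exp_factors_eq`). Without e^{-z²/8}, monomials are orthogonal on the polydisc for the
radial weight, so the coefficients of G are the prescribed moments divided by norms; these norms
grow fast enough on a large polydisc for the power series to converge beyond it
(`exists_analytic_moments`). The factor e^{-z²/8} acts on moment sequences as exp(-T/8), where
(Ta)_α = ∑_j a_{α+2e_j}. On sequences of geometric growth T is bounded, so exp(-T/8) is invertible,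
and it suffices to prescribe exp(T/8) a instead (`exists_hasSum_shiftSum`).

Matching Hermite coefficients gives f = V_φ^* F because V_φ^* F is itself an L² function, by the
density argument, and the Hermite functions are complete in L²
(`ae_eq_zero_of_hermiteCoeff_eq_zero`). The implications (4) to (3) to (2) are inclusions, a bounded
function of compact support being a Gevrey distribution. -/

/-! ### Differentiation of integrals of functions of linear forms -/

section ParametricIntegral

variable {T : Type} [MeasurableSpace T] {μ : Measure T}
  {E : Type} [NormedAddCommGroup E] [NormedSpace ℝ E]

theorem norm_smulRight_complex_le {F : Type} [NormedAddCommGroup F] [NormedSpace ℝ F]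
    [NormedSpace ℂ F] [IsScalarTower ℝ ℂ F] (L : E →L[ℝ] ℂ) (c : F) :
    ‖L.smulRight c‖ ≤ ‖L‖ * ‖c‖ := by
  refine ContinuousLinearMap.opNorm_le_bound _ (by positivity) fun x => ?_
  rw [ContinuousLinearMap.smulRight_apply, norm_smul, mul_right_comm]
  gcongr
  exact L.le_opNorm x

theorem continuous_smulRight_complex {F : Type} [NormedAddCommGroup F] [NormedSpace ℝ F]
    [NormedSpace ℂ F] [IsScalarTower ℝ ℂ F] :
    Continuous (fun q : (E →L[ℝ] ℂ) × F => q.1.smulRight q.2) := by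
  have h : IsBoundedBilinearMap ℝ (fun q : (E →L[ℝ] ℂ) × F => q.1.smulRight q.2) :=
    { add_left := fun x y z => by ext; simp [add_smul]
      smul_left := fun a x z => by ext y; exact smul_assoc a (x y) z
      add_right := fun x y z => by ext; simp
      smul_right := fun a x z => by ext y; exact smul_comm (x y) a z
      bound := ⟨1, one_pos, fun x y => by
        rw [one_mul]; exact norm_smulRight_complex_le x y⟩ }
  exact h.continuous

/-- Differentiation under the integral sign, dominated on the unit ball around p. The chain rule
produces a factor ‖L t‖, which is absorbed by e^{‖L t‖}; integrability of c against every e^{R‖L t‖}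
pays for this loss. -/
theorem hasFDerivAt_integral_smul_of_exp_bound {F : Type} [NormedAddCommGroup F] [NormedSpace ℝ F]
    [NormedSpace ℂ F] [IsScalarTower ℝ ℂ F] {L : T → E →L[ℝ] ℂ} (hL : AEStronglyMeasurable L μ)
    {c : T → F} (hc : AEStronglyMeasurable c μ)
    (hint : ∀ R : ℝ, Integrable (fun t => Real.exp (R * ‖L t‖) * ‖c t‖) μ)
    {u v : ℂ → ℂ} (huv : ∀ w, HasDerivAt u (v w) w) (hv : Continuous v) {A B : ℝ} (hA : 0 ≤ A)
    (hu_le : ∀ w, ‖u w‖ ≤ B * Real.exp (A * ‖w‖)) (hv_le : ∀ w, ‖v w‖ ≤ B * Real.exp (A * ‖w‖))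
    (p : E) :
    HasFDerivAt (fun p => ∫ t, u (L t p) • c t ∂μ)
      (∫ t, v (L t p) • (L t).smulRight (c t) ∂μ) p := by
  have hu : Continuous u := continuous_iff_continuousAt.2 fun w => (huv w).continuousAt
  have hB : 0 ≤ B := by
    have := (norm_nonneg _).trans (hu_le 0)
    simpa using this
  have hLp : ∀ p : E, AEStronglyMeasurable (fun t => L t p) μ := fun p =>
    (ContinuousLinearMap.apply ℝ ℂ p).continuous.comp_aestronglyMeasurable hL
  refine hasFDerivAt_integral_of_dominated_of_fderiv_le (𝕜 := ℝ) (s := Metric.ball p 1)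
    (F' := fun p t => v (L t p) • (L t).smulRight (c t))
    (bound := fun t => B * (Real.exp ((A * (‖p‖ + 1) + 1) * ‖L t‖) * ‖c t‖))
    (Metric.ball_mem_nhds p one_pos) ?_ ?_ ?_ ?_ ?_ ?_
  · exact Filter.Eventually.of_forall fun q =>
      (hu.comp_aestronglyMeasurable (hLp q)).smul hc
  · refine ((hint (A * ‖p‖)).const_mul B).mono'
      ((hu.comp_aestronglyMeasurable (hLp p)).smul hc) (Filter.Eventually.of_forall fun t => ?_)
    rw [norm_smul, ← mul_assoc]
    gcongr
    refine (hu_le _).trans ?_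
    rw [mul_assoc A, mul_comm ‖p‖]
    gcongr
    exact (L t).le_opNorm p
  · refine (hv.comp_aestronglyMeasurable (hLp p)).smul ?_
    exact continuous_smulRight_complex.comp_aestronglyMeasurable (hL.prodMk hc)
  · refine Filter.Eventually.of_forall fun t q hq => ?_
    have hq' : ‖q‖ ≤ ‖p‖ + 1 := by
      have := norm_sub_norm_le q p
      rw [Metric.mem_ball, dist_eq_norm] at hq
      linarith
    rw [norm_smul]
    calc ‖v (L t q)‖ * ‖(L t).smulRight (c t)‖
        ≤ (B * Real.exp (A * (‖L t‖ * (‖p‖ + 1)))) * (‖L t‖ * ‖c t‖) := by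
          gcongr
          · refine (hv_le _).trans ?_
            gcongr
            exact ((L t).le_opNorm q).trans (by gcongr)
          · exact norm_smulRight_complex_le _ _
      _ ≤ (B * Real.exp (A * (‖L t‖ * (‖p‖ + 1)))) * (Real.exp ‖L t‖ * ‖c t‖) := by
          gcongr
          linarith [Real.add_one_le_exp ‖L t‖]
      _ = _ := by
          rw [show (A * (‖p‖ + 1) + 1) * ‖L t‖ = A * (‖L t‖ * (‖p‖ + 1)) + ‖L t‖ by ring,
            Real.exp_add]
          ring
  · exact (hint _).const_mul B
  · refine Filter.Eventually.of_forall fun t q _ => ?_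
    have h1 := ((huv (L t q)).hasFDerivAt.restrictScalars ℝ).comp q (L t).hasFDerivAt
    have h2 := h1.smul_const (c t)
    refine h2.congr_fderiv ?_
    ext x
    simp [smul_smul, mul_comm]

/-- Derivative bounds for integrals of functions of linear forms. -/
theorem contDiff_integral_and_norm_iteratedFDeriv_le {L : T → E →L[ℝ] ℂ}
    (hL : AEStronglyMeasurable L μ) {A : ℝ} (hA : 0 ≤ A) (n : ℕ) :
    ∀ {F : Type} [NormedAddCommGroup F] [NormedSpace ℝ F] [NormedSpace ℂ F] [IsScalarTower ℝ ℂ F]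
    {c : T → F} (_ : AEStronglyMeasurable c μ)
    (_ : ∀ R : ℝ, Integrable (fun t => Real.exp (R * ‖L t‖) * ‖c t‖) μ)
    {u : ℕ → ℂ → ℂ} (_ : ∀ k w, HasDerivAt (u k) (u (k + 1) w) w) {B : ℕ → ℝ} (_ : Monotone B)
    (_ : ∀ k w, ‖u k w‖ ≤ B k * Real.exp (A * ‖w‖)),
    ContDiff ℝ n (fun p => ∫ t, u 0 (L t p) • c t ∂μ) ∧
    ∀ p, ‖iteratedFDeriv ℝ n (fun p => ∫ t, u 0 (L t p) • c t ∂μ) p‖ ≤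
      B n * ∫ t, Real.exp (A * ‖p‖ * ‖L t‖) * ‖L t‖ ^ n * ‖c t‖ ∂μ := by
  -- The target F and the density c stay universally quantified, because the derivative is again an
  -- integral of this type, with density `(L t).smulRight (c t)` valued in the linear maps from E to
  -- F.
  induction n with
  | zero =>
    intro F _ _ _ _ c hc hint u hu B hB hub
    constructor
    · have := fun p => hasFDerivAt_integral_smul_of_exp_bound hL hc hint (hu 0)
        (continuous_iff_continuousAt.2 fun w => (hu 1 w).continuousAt) hA
        (fun w => (hub 0 w).trans (by gcongr; exact hB zero_le_one)) (hub 1) p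
      exact contDiff_zero.2 (continuous_iff_continuousAt.2 fun p => (this p).continuousAt)
    · intro p
      rw [norm_iteratedFDeriv_zero, ← integral_const_mul]
      refine norm_integral_le_of_norm_le ?_ (Filter.Eventually.of_forall fun t => ?_)
      · simpa using (hint (A * ‖p‖)).const_mul (B 0)
      · rw [norm_smul, pow_zero, mul_one, ← mul_assoc]
        gcongr
        refine (hub 0 _).trans ?_
        have h0 : 0 ≤ B 0 := by
          have := (norm_nonneg _).trans (hub 0 0)
          simpa using this
        rw [mul_assoc A, mul_comm ‖p‖]
        gcongr
        exact (L t).le_opNorm p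
  | succ n ih =>
    intro F _ _ _ _ c hc hint u hu B hB hub
    have hd := fun p => hasFDerivAt_integral_smul_of_exp_bound hL hc hint (hu 0)
        (continuous_iff_continuousAt.2 fun w => (hu 1 w).continuousAt) hA
        (fun w => (hub 0 w).trans (by gcongr; exact hB zero_le_one)) (hub 1) p
    have hc' : AEStronglyMeasurable (fun t => (L t).smulRight (c t)) μ :=
      continuous_smulRight_complex.comp_aestronglyMeasurable (hL.prodMk hc)
    have hB0 : ∀ k, 0 ≤ B k := fun k => by
      have := (norm_nonneg _).trans (hub k 0)
      simpa using this
    have hle : ∀ (R : ℝ) (t : T), Real.exp (R * ‖L t‖) * (‖L t‖ * ‖c t‖) ≤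
        Real.exp ((R + 1) * ‖L t‖) * ‖c t‖ := fun R t => by
      rw [add_mul, one_mul, Real.exp_add, ← mul_assoc]
      gcongr
      linarith [Real.add_one_le_exp ‖L t‖]
    have hmeas : ∀ R : ℝ, AEStronglyMeasurable (fun t => Real.exp (R * ‖L t‖)) μ := fun R =>
      (Real.continuous_exp.comp (continuous_const.mul continuous_norm)).comp_aestronglyMeasurable
        hL
    have hint' : ∀ R : ℝ, Integrable (fun t => Real.exp (R * ‖L t‖) *
        ‖(L t).smulRight (c t)‖) μ := fun R => by
      refine (hint (R + 1)).mono' ((hmeas R).mul hc'.norm) (Filter.Eventually.of_forall fun t => ?_)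
      rw [Real.norm_of_nonneg (by positivity)]
      refine le_trans ?_ (hle R t)
      gcongr
      exact norm_smulRight_complex_le _ _
    -- The derivative replaces the chain u by its shift, and the n-th bound for the shifted chain is
    -- `B (n + 1)`.
    have key := ih hc' hint' (u := fun k => u (k + 1)) (fun k w => hu (k + 1) w)
      (B := fun k => B (k + 1)) (fun i j hij => hB (by lia)) (fun k w => hub (k + 1) w)
    have hfd : fderiv ℝ (fun p => ∫ t, u 0 (L t p) • c t ∂μ) =
        fun p => ∫ t, u (0 + 1) (L t p) • (L t).smulRight (c t) ∂μ := by
      ext1 p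
      exact (hd p).fderiv
    constructor
    · push_cast
      rw [contDiff_succ_iff_fderiv]
      refine ⟨fun p => (hd p).differentiableAt, by simp, ?_⟩
      rw [hfd]
      exact key.1
    · intro p
      rw [← norm_iteratedFDeriv_fderiv, hfd]
      refine (key.2 p).trans ?_
      refine mul_le_mul_of_nonneg_left ?_ (hB0 _)
      have hpow : ∀ t, ‖L t‖ ^ n * ‖(L t).smulRight (c t)‖ ≤ ‖L t‖ ^ (n + 1) * ‖c t‖ := fun t => by
        rw [pow_succ, mul_assoc]
        gcongr
        exact norm_smulRight_complex_le _ _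
      refine integral_mono_of_nonneg (Filter.Eventually.of_forall fun t => by positivity) ?_
        (Filter.Eventually.of_forall fun t => ?_)
      · refine ((hint (A * ‖p‖ + 1)).const_mul ((n + 1)! : ℝ)).mono'
          (((hmeas _).mul (hL.norm.pow _)).mul hc.norm) (Filter.Eventually.of_forall fun t => ?_)
        rw [Real.norm_of_nonneg (by positivity), add_mul, one_mul, Real.exp_add]
        have := Real.pow_div_factorial_le_exp ‖L t‖ (norm_nonneg _) (n + 1)
        rw [div_le_iff₀ (by positivity)] at this
        calc _ ≤ Real.exp (A * ‖p‖ * ‖L t‖) * (Real.exp ‖L t‖ * ((n + 1)! : ℝ)) * ‖c t‖ := by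
              gcongr
          _ = _ := by ring
      · simp only [mul_assoc]
        exact mul_le_mul_of_nonneg_left (hpow t) (Real.exp_pos _).le

end ParametricIntegral

/-! ### Derivative bounds with factorial growth -/

section FactorialBounds

variable {E : Type} [NormedAddCommGroup E] [NormedSpace ℝ E]

/-- `‖D^n f(x)‖ ≤ A a^n n!` for all `n` and all `x ∈ K`. -/
def FactorialBoundOn (K : Set E) (a A : ℝ) (f : E → ℂ) : Prop :=
  ∀ (n : ℕ), ∀ x ∈ K, ‖iteratedFDeriv ℝ n f x‖ ≤ A * a ^ n * (n ! : ℝ)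

theorem FactorialBoundOn.gevreyBoundOn {K : Set E} {a A s : ℝ} {f : E → ℂ}
    (h : FactorialBoundOn K a A f) (hA : 0 ≤ A) (ha : 0 ≤ a) (hs : 1 ≤ s) :
    GevreyBoundOn s K a A f := fun n x hx => by
  refine (h n x hx).trans ?_
  gcongr
  exact Real.self_le_rpow_of_one_le (by exact_mod_cast Nat.one_le_iff_ne_zero.2 n.factorial_ne_zero)
    hs

/-- In the Leibniz formula the binomial coefficient turns i! (n-i)! into n!. The remaining sum of
a^i b^{n-i} is at most (a+b)^n, since the binomial coefficients are at least 1. -/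
theorem FactorialBoundOn.mul {K : Set E} {a A b B : ℝ} {f g : E → ℂ} (hf : ContDiff ℝ ∞ f)
    (hg : ContDiff ℝ ∞ g) (ha : 0 ≤ a) (hb : 0 ≤ b) (hA : 0 ≤ A)
    (h : FactorialBoundOn K a A f) (h' : FactorialBoundOn K b B g) :
    FactorialBoundOn K (a + b) (A * B) (fun x => f x * g x) := fun n x hx => by
  refine (norm_iteratedFDeriv_mul_le hf hg x (n := n) (by exact_mod_cast le_top)).trans ?_
  rw [add_pow, Finset.mul_sum, Finset.sum_mul]
  refine Finset.sum_le_sum fun i hi => ?_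
  have hi' : i ≤ n := Nat.lt_succ_iff.1 (Finset.mem_range.1 hi)
  calc (n.choose i : ℝ) * ‖iteratedFDeriv ℝ i f x‖ * ‖iteratedFDeriv ℝ (n - i) g x‖
      ≤ (n.choose i : ℝ) * (A * a ^ i * (i ! : ℝ)) * (B * b ^ (n - i) * ((n - i)! : ℝ)) := by
        gcongr
        · exact h i x hx
        · exact h' (n - i) x hx
    _ = A * B * (a ^ i * b ^ (n - i)) * ((n.choose i * i ! * (n - i)! : ℕ) : ℝ) := by
        push_cast; ring
    _ = A * B * (a ^ i * b ^ (n - i)) * (n ! : ℝ) := by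
        rw [Nat.choose_mul_factorial_mul_factorial hi']
    _ ≤ A * B * (a ^ i * b ^ (n - i) * (n.choose i : ℝ)) * (n ! : ℝ) := by
        have hB : 0 ≤ B := by
          have := (norm_nonneg _).trans (h' 0 x hx)
          simpa using this
        refine mul_le_mul_of_nonneg_right (mul_le_mul_of_nonneg_left ?_ (by positivity))
          (by positivity)
        refine le_mul_of_one_le_right (by positivity) ?_
        exact_mod_cast Nat.choose_pos hi'

theorem norm_iteratedFDeriv_clm_add_two (ℓ : E →L[ℝ] ℂ) (n : ℕ) (x : E) :
    iteratedFDeriv ℝ (n + 2) ℓ x = 0 := by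
  rw [← norm_eq_zero, ← norm_iteratedFDeriv_fderiv]
  have : fderiv ℝ ℓ = fun _ => ℓ := by ext1 x; exact ℓ.fderiv
  rw [this, iteratedFDeriv_succ_const]
  simp

/-- Multiplication by a linear form keeps the geometric rate of the bounds. -/
theorem FactorialBoundOn.clm_mul {K : Set E} {a A R ρ : ℝ} {f : E → ℂ} (hf : ContDiff ℝ ∞ f)
    (ha : 1 ≤ a) (h : FactorialBoundOn K a A f) (ℓ : E →L[ℝ] ℂ) (hℓ : ‖ℓ‖ ≤ ρ)
    (hR : ∀ x ∈ K, ‖ℓ x‖ ≤ R) :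
    FactorialBoundOn K a ((R + ρ) * A) (fun x => ℓ x * f x) := fun n x hx => by
  have hA : 0 ≤ A := by
    have := (norm_nonneg _).trans (h 0 x hx)
    simpa using this
  have hρ : 0 ≤ ρ := (norm_nonneg _).trans hℓ
  refine (norm_iteratedFDeriv_mul_le (N := ∞) ℓ.contDiff hf x (n := n)
    (by exact_mod_cast le_top)).trans ?_
  have h0 : ‖iteratedFDeriv ℝ 0 ℓ x‖ ≤ R := by simpa using hR x hx
  have h1 : ‖iteratedFDeriv ℝ 1 ℓ x‖ ≤ ρ := by
    rw [norm_iteratedFDeriv_one, ℓ.fderiv]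
    exact hℓ
  have hR0 : 0 ≤ R := (norm_nonneg _).trans h0
  rcases n with _ | n
  · simp only [zero_add, Finset.range_one, Finset.sum_singleton, Nat.choose_self, Nat.cast_one,
      one_mul]
    calc _ ≤ R * (A * a ^ 0 * (0 ! : ℝ)) := by
            gcongr
            exact h 0 x hx
      _ = R * A := by simp
      _ ≤ _ := by
          simp only [pow_zero, mul_one, Nat.factorial_zero, Nat.cast_one]
          gcongr
          linarith
  -- Only the derivatives of ℓ of order 0 and 1 survive. The term of order 1 carries the factor n +
  -- 1, which completes n! to (n+1)!; a ≥ 1 makes up for its missing power of a.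
  · rw [Finset.sum_range_succ', Finset.sum_range_succ']
    have hz : ∑ k ∈ Finset.range n, ((n + 1).choose (k + 1 + 1) : ℝ) *
        ‖iteratedFDeriv ℝ (k + 1 + 1) ℓ x‖ * ‖iteratedFDeriv ℝ (n + 1 - (k + 1 + 1)) f x‖ = 0 :=
      Finset.sum_eq_zero fun k _ => by rw [norm_iteratedFDeriv_clm_add_two]; simp
    rw [hz]
    simp only [zero_add, Nat.choose_one_right, Nat.choose_zero_right, Nat.cast_one, one_mul,
      Nat.sub_zero]
    have hn := h n x hx
    have hn1 := h (n + 1) x hx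
    have hpow : a ^ n ≤ a ^ (n + 1) := pow_le_pow_right₀ ha n.le_succ
    calc _ ≤ ((n + 1 : ℕ) : ℝ) * ρ * (A * a ^ (n + 1) * (n ! : ℝ)) +
          R * (A * a ^ (n + 1) * ((n + 1)! : ℝ)) := by
            gcongr
            exact hn.trans (by gcongr)
      _ = _ := by rw [Nat.factorial_succ]; push_cast; ring

end FactorialBounds

/-! ### Taylor remainders of the exponential inside an integral -/

section ExpTail

/-- The remainder of the Taylor series of the exponential function. -/
noncomputable def expTail (m : ℕ) (w : ℂ) : ℂ :=
  Complex.exp w - ∑ n ∈ Finset.range m, w ^ n / (n ! : ℂ)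

theorem expTail_zero : expTail 0 = Complex.exp := by
  ext w; simp [expTail]

/-- The truncated subtraction is intended: the remainder of order 0 is the exponential, which is its
own derivative. Thus k ↦ `expTail (m - k)` is a chain of successive derivatives for all k. -/
theorem hasDerivAt_expTail (m : ℕ) (w : ℂ) : HasDerivAt (expTail m) (expTail (m - 1) w) w := by
  rcases m with _ | m
  · simpa [expTail_zero] using Complex.hasDerivAt_exp w
  · unfold expTail
    refine (Complex.hasDerivAt_exp w).sub ?_
    rw [Nat.add_sub_cancel]
    have h : ∀ n ∈ Finset.range (m + 1), HasDerivAt (fun w : ℂ => w ^ n / (n ! : ℂ))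
        ((n : ℂ) * w ^ (n - 1) / (n ! : ℂ)) w := fun n _ =>
      (hasDerivAt_pow n w).div_const _
    refine (HasDerivAt.fun_sum h).congr_deriv ?_
    rw [Finset.sum_range_succ']
    simp only [Nat.cast_zero, zero_mul, zero_div, add_zero, Nat.add_sub_cancel]
    refine Finset.sum_congr rfl fun n _ => ?_
    rw [Nat.factorial_succ]
    push_cast
    have : (n : ℂ) + 1 ≠ 0 := by exact_mod_cast n.succ_ne_zero
    field_simp

/-- The tail of the series for e^{|w|} is compared termwise with that for e^{2|w|}: for n ≥ m one
has |w|^n ≤ 2^{-m} (2|w|)^n. Doubling the exponent thus buys geometric decay in m. -/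
theorem norm_expTail_le (m : ℕ) (w : ℂ) :
    ‖expTail m w‖ ≤ (1 / 2) ^ m * Real.exp (2 * ‖w‖) := by
  refine (Complex.norm_exp_sub_sum_le_exp_norm_sub_sum w m).trans ?_
  have h1 : HasSum (fun n : ℕ => ‖w‖ ^ n / (n ! : ℝ)) (Real.exp ‖w‖) := by
    rw [Real.exp_eq_exp_ℝ]; exact NormedSpace.expSeries_div_hasSum_exp ‖w‖
  have h2 : HasSum (fun n : ℕ => (2 * ‖w‖) ^ n / (n ! : ℝ)) (Real.exp (2 * ‖w‖)) := by
    rw [Real.exp_eq_exp_ℝ]; exact NormedSpace.expSeries_div_hasSum_exp (2 * ‖w‖)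
  have h3 := (hasSum_nat_add_iff' m).2 h1
  have h4 := ((hasSum_nat_add_iff' m).2 h2).mul_left ((1 / 2 : ℝ) ^ m)
  refine (hasSum_le (fun n => ?_) h3 h4).trans ?_
  · rw [mul_pow, pow_add (2 : ℝ)]
    have : (1 : ℝ) ≤ 2 ^ n := one_le_pow₀ (by norm_num)
    rw [mul_div_assoc, ← mul_assoc, ← mul_assoc, mul_comm ((1 / 2 : ℝ) ^ m), mul_assoc (2 ^ n : ℝ),
      ← mul_pow]
    norm_num
    exact le_mul_of_one_le_left (by positivity) this
  · refine mul_le_mul_of_nonneg_left ?_ (by positivity)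
    rw [sub_le_self_iff]
    exact Finset.sum_nonneg fun _ _ => by positivity

variable {T : Type} [MeasurableSpace T] {μ : Measure T}
  {E : Type} [NormedAddCommGroup E] [NormedSpace ℝ E]

/-- The rate 2 does not depend on m, K or c, while the constant decays like 2^{-m}. This makes
Taylor remainders tend to zero in a single Gevrey norm. -/
theorem integral_expTail_bounds {L : T → E →L[ℝ] ℂ}
    (hL : AEStronglyMeasurable L μ) {c : T → ℂ} (hc : AEStronglyMeasurable c μ)
    (hint : ∀ R : ℝ, Integrable (fun t => Real.exp (R * ‖L t‖) * ‖c t‖) μ) (m : ℕ)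
    {K : Set E} {R : ℝ} (hK : ∀ p ∈ K, ‖p‖ ≤ R) :
    ContDiff ℝ ∞ (fun p => ∫ t, expTail m (L t p) * c t ∂μ) ∧
    FactorialBoundOn K 2 ((1 / 2) ^ m * ∫ t, Real.exp ((2 * R + 1) * ‖L t‖) * ‖c t‖ ∂μ)
      (fun p => ∫ t, expTail m (L t p) * c t ∂μ) := by
  -- Each derivative lowers the order of the remainder by one and so loses a factor 2 from 2^{-m}:
  -- the k-th derivative is bounded by 2^{-m} 2^k e^{2|w|}, also after the order has reached 0.
  have key := fun n => contDiff_integral_and_norm_iteratedFDeriv_le hL (zero_le_two (α := ℝ)) n hc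
    hint (u := fun k => expTail (m - k)) (fun k w => hasDerivAt_expTail (m - k) w)
    (B := fun k => (1 / 2) ^ m * 2 ^ k)
    (fun i j hij => by
      simp only
      gcongr
      exact one_le_two)
    (fun k w => (norm_expTail_le _ w).trans (by
      gcongr
      rcases le_total k m with hk | hk
      · obtain ⟨l, rfl⟩ := Nat.exists_eq_add_of_le hk
        rw [Nat.add_sub_cancel_left, pow_add, mul_assoc, mul_comm ((1 / 2 : ℝ) ^ l), ← mul_assoc,
          ← mul_pow]
        norm_num
      · rw [Nat.sub_eq_zero_of_le hk, pow_zero]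
        obtain ⟨l, rfl⟩ := Nat.exists_eq_add_of_le hk
        rw [pow_add, ← mul_assoc, ← mul_pow]
        norm_num
        exact one_le_pow₀ (by norm_num)))
  simp only [Nat.sub_zero, smul_eq_mul] at key
  refine ⟨contDiff_infty.2 fun n => (key n).1, fun n p hp => ((key n).2 p).trans ?_⟩
  suffices h : ∫ t, Real.exp (2 * ‖p‖ * ‖L t‖) * ‖L t‖ ^ n * ‖c t‖ ∂μ ≤
      (n ! : ℝ) * ∫ t, Real.exp ((2 * R + 1) * ‖L t‖) * ‖c t‖ ∂μ by
    calc _ ≤ (1 / 2) ^ m * 2 ^ n *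
          ((n ! : ℝ) * ∫ t, Real.exp ((2 * R + 1) * ‖L t‖) * ‖c t‖ ∂μ) := by gcongr
      _ = _ := by ring
  rw [← integral_const_mul]
  refine integral_mono_of_nonneg (Filter.Eventually.of_forall fun t => by positivity)
    ((hint _).const_mul _) (Filter.Eventually.of_forall fun t => ?_)
  have hpow := Real.pow_div_factorial_le_exp ‖L t‖ (norm_nonneg _) n
  rw [div_le_iff₀ (by positivity)] at hpow
  simp only
  rw [add_mul, one_mul, Real.exp_add]
  calc _ ≤ Real.exp (2 * R * ‖L t‖) * (Real.exp ‖L t‖ * (n ! : ℝ)) * ‖c t‖ := by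
        gcongr
        exact hK p hp
    _ = _ := by ring

end ExpTail

noncomputable section

/-! ### Complex coordinates and linear forms on phase space -/

section PhaseSpace

variable {d : ℕ}

/-- The complex coordinate `z_j = x_j + i ξ_j` on phase space. -/
def zCoord (j : Fin d) : (RSp d × RSp d) →L[ℝ] ℂ :=
  Complex.ofRealCLM.comp ((EuclideanSpace.proj j).comp (ContinuousLinearMap.fst ℝ _ _)) +
    Complex.I • Complex.ofRealCLM.comp ((EuclideanSpace.proj j).comp (ContinuousLinearMap.snd ℝ _ _))

theorem zCoord_apply (j : Fin d) (p : RSp d × RSp d) :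
    zCoord j p = (p.1 j : ℂ) + Complex.I * (p.2 j : ℂ) := rfl

theorem norm_zCoord_apply_le (j : Fin d) (p : RSp d × RSp d) : ‖zCoord j p‖ ≤ 2 * ‖p‖ := by
  rw [zCoord_apply]
  refine (norm_add_le _ _).trans ?_
  rw [norm_mul, Complex.norm_I, one_mul, Complex.norm_real, Complex.norm_real]
  have h1 := (PiLp.norm_apply_le p.1 j).trans (norm_fst_le p)
  have h2 := (PiLp.norm_apply_le p.2 j).trans (norm_snd_le p)
  linarith

theorem norm_zCoord_le (j : Fin d) : ‖(zCoord j : (RSp d × RSp d) →L[ℝ] ℂ)‖ ≤ 2 :=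
  ContinuousLinearMap.opNorm_le_bound _ zero_le_two (norm_zCoord_apply_le j)

/-- The form `t ↦ (p ↦ ∑ j, t_j z_j(p))`. -/
def dualForm : RSp d →L[ℝ] (RSp d × RSp d) →L[ℝ] ℂ :=
  ∑ j, (EuclideanSpace.proj j : RSp d →L[ℝ] ℝ).smulRight (zCoord j)

theorem dualForm_apply (t : RSp d) (p : RSp d × RSp d) :
    dualForm t p = ∑ j, (t j : ℂ) * zCoord j p := by
  simp [dualForm]

theorem dualForm_eq_inner (t : RSp d) (p : RSp d × RSp d) :
    dualForm t p = (inner ℝ t p.1 : ℝ) + Complex.I * (inner ℝ t p.2 : ℝ) := by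
  rw [dualForm_apply]
  simp only [zCoord_apply, PiLp.inner_apply, RCLike.inner_apply, conj_trivial]
  push_cast
  rw [Finset.mul_sum, ← Finset.sum_add_distrib]
  exact Finset.sum_congr rfl fun j _ => by ring

/-- The form `t ↦ (p ↦ i ⟨t, x⟩)`, `p = (x, ξ)`. -/
def positionForm : RSp d →L[ℝ] (RSp d × RSp d) →L[ℝ] ℂ :=
  ∑ j, (EuclideanSpace.proj j : RSp d →L[ℝ] ℝ).smulRight
    (Complex.I • Complex.ofRealCLM.comp
      ((EuclideanSpace.proj j : RSp d →L[ℝ] ℝ).comp (ContinuousLinearMap.fst ℝ (RSp d) (RSp d))))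

theorem positionForm_apply (t : RSp d) (p : RSp d × RSp d) :
    positionForm t p = Complex.I * (inner ℝ p.1 t : ℝ) := by
  simp only [positionForm, _root_.sum_apply, ContinuousLinearMap.smulRight_apply,
    PiLp.inner_apply, RCLike.inner_apply, conj_trivial]
  push_cast
  rw [Finset.mul_sum]
  refine Finset.sum_congr rfl fun j _ => ?_
  simp
  ring

end PhaseSpace

/-! ### Densities integrable against all exponentials -/

section ExpIntegrable

variable {d : ℕ}

/-- `c` is measurable and integrable against every exponential `e^{R|t|}`. -/
structure ExpIntegrable (c : RSp d → ℂ) : Prop where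
  aestronglyMeasurable : AEStronglyMeasurable c volume
  integrable : ∀ R : ℝ, Integrable (fun t => Real.exp (R * ‖t‖) * ‖c t‖) volume

theorem ExpIntegrable.of_norm_le {c : RSp d → ℂ} {b : RSp d → ℂ} (hb : ExpIntegrable b)
    (hc : AEStronglyMeasurable c volume) {C R : ℝ}
    (h : ∀ t, ‖c t‖ ≤ C * (Real.exp (R * ‖t‖) * ‖b t‖)) : ExpIntegrable c := by
  refine ⟨hc, fun S => ((hb.integrable (S + R)).const_mul C).mono' ?_ ?_⟩
  · exact (Real.continuous_exp.comp (continuous_const.mul continuous_norm)).aestronglyMeasurable.mul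
      hc.norm
  · refine Filter.Eventually.of_forall fun t => ?_
    rw [Real.norm_of_nonneg (by positivity), add_mul, Real.exp_add]
    calc _ ≤ Real.exp (S * ‖t‖) * (C * (Real.exp (R * ‖t‖) * ‖b t‖)) := by gcongr; exact h t
      _ = _ := by ring

theorem ExpIntegrable.integrable_forms {c : RSp d → ℂ} (hc : ExpIntegrable c) {V : Type}
    [NormedAddCommGroup V] [NormedSpace ℝ V] (L : RSp d →L[ℝ] V →L[ℝ] ℂ) (R : ℝ) :
    Integrable (fun t => Real.exp (R * ‖L t‖) * ‖c t‖) volume := by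
  refine (hc.integrable (|R| * ‖L‖)).mono' ?_ (Filter.Eventually.of_forall fun t => ?_)
  · exact (Real.continuous_exp.comp
      (continuous_const.mul L.continuous.norm)).aestronglyMeasurable.mul
      hc.aestronglyMeasurable.norm
  · rw [Real.norm_of_nonneg (by positivity)]
    gcongr ?_ * _
    rw [Real.exp_le_exp, mul_assoc]
    exact (mul_le_mul_of_nonneg_right (le_abs_self R) (norm_nonneg _)).trans
      (by gcongr; exact L.le_opNorm t)

theorem ExpIntegrable.integrable_exp_mul {c : RSp d → ℂ} (hc : ExpIntegrable c) {V : Type}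
    [NormedAddCommGroup V] [NormedSpace ℝ V] (L : RSp d →L[ℝ] V →L[ℝ] ℂ) (p : V) :
    Integrable (fun t => Complex.exp (L t p) * c t) volume := by
  refine (hc.integrable_forms L ‖p‖).mono' ?_ (Filter.Eventually.of_forall fun t => ?_)
  · exact (Complex.continuous_exp.comp ((ContinuousLinearMap.apply ℝ ℂ p).continuous.comp
      L.continuous)).aestronglyMeasurable.mul hc.aestronglyMeasurable
  · rw [norm_mul]
    gcongr
    refine (Complex.norm_exp_le_exp_norm _).trans ?_
    rw [mul_comm]
    exact Real.exp_le_exp.2 ((L t).le_opNorm p)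

theorem ExpIntegrable.const_mul {c : RSp d → ℂ} (hc : ExpIntegrable c) (a : ℂ) :
    ExpIntegrable (fun t => a * c t) :=
  hc.of_norm_le (hc.aestronglyMeasurable.const_mul a) (C := ‖a‖) (R := 0) fun t => by simp

/-- The exponential integral `p ↦ ∫ e^{L_t p} c(t) dt` and the remainders of its expansion. -/
theorem ExpIntegrable.expTail_bounds {c : RSp d → ℂ} (hc : ExpIntegrable c) {V : Type}
    [NormedAddCommGroup V] [NormedSpace ℝ V] (L : RSp d →L[ℝ] V →L[ℝ] ℂ) (m : ℕ)
    {K : Set V} {R : ℝ} (hK : ∀ p ∈ K, ‖p‖ ≤ R) :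
    ContDiff ℝ ∞ (fun p => ∫ t, expTail m (L t p) * c t) ∧
    FactorialBoundOn K 2 ((1 / 2) ^ m * ∫ t, Real.exp ((2 * R + 1) * ‖L t‖) * ‖c t‖)
      (fun p => ∫ t, expTail m (L t p) * c t) :=
  integral_expTail_bounds L.continuous.aestronglyMeasurable hc.aestronglyMeasurable
    (hc.integrable_forms L) m hK

theorem ExpIntegrable.exp_bounds {c : RSp d → ℂ} (hc : ExpIntegrable c) {V : Type}
    [NormedAddCommGroup V] [NormedSpace ℝ V] (L : RSp d →L[ℝ] V →L[ℝ] ℂ) :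
    ContDiff ℝ ∞ (fun p => ∫ t, Complex.exp (L t p) * c t) ∧
    ∀ K : Set V, IsCompact K → ∃ A : ℝ, 0 ≤ A ∧ FactorialBoundOn K 2 A
      (fun p => ∫ t, Complex.exp (L t p) * c t) := by
  have h := fun (K : Set V) (R : ℝ) => hc.expTail_bounds L 0 (K := K) (R := R)
  simp only [expTail_zero] at h
  refine ⟨(h ∅ 0 (by simp)).1, fun K hK => ?_⟩
  obtain ⟨R, hR⟩ := hK.isBounded.exists_norm_le
  exact ⟨_, by positivity, (h K R hR).2⟩

/-- The Gaussian `e^{-b|t|²}`, `b > 0`, is integrable against every `e^{R|t|}`. -/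
theorem expIntegrable_gaussian {b : ℝ} (hb : 0 < b) :
    ExpIntegrable (fun t : RSp d => ((Real.exp (-b * ‖t‖ ^ 2) : ℝ) : ℂ)) := by
  have hcont : Continuous (fun t : RSp d => Real.exp (-b * ‖t‖ ^ 2)) := by fun_prop
  refine ⟨(Complex.continuous_ofReal.comp hcont).aestronglyMeasurable, fun R => ?_⟩
  -- Half of the Gaussian absorbs the exponential: completing the square gives R|t| - b|t|²/2 ≤
  -- R²/(2b).
  have h := (GaussianFourier.integrable_cexp_neg_mul_sq_norm_add (V := RSp d) (b := (b / 2 : ℝ))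
    (by rw [Complex.ofReal_re]; positivity) 0 0).norm.const_mul (Real.exp (R ^ 2 / (2 * b)))
  refine h.mono' ?_ (Filter.Eventually.of_forall fun t => ?_)
  · exact ((Real.continuous_exp.comp (continuous_const.mul continuous_norm)).mul
      (Complex.continuous_ofReal.comp hcont).norm).aestronglyMeasurable
  · have e : (-((b / 2 : ℝ) : ℂ) * (‖t‖ : ℂ) ^ 2 + 0 * ((inner ℝ (0 : RSp d) t : ℝ) : ℂ)) =
        ((-(b / 2) * ‖t‖ ^ 2 : ℝ) : ℂ) := by push_cast; ring
    rw [e, ← Complex.ofReal_exp, Complex.norm_real, Complex.norm_real, Real.norm_of_nonneg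
      (by positivity), Real.norm_of_nonneg (Real.exp_pos _).le, Real.norm_of_nonneg
      (Real.exp_pos _).le, ← Real.exp_add, ← Real.exp_add, Real.exp_le_exp]
    have : 0 ≤ (R - b * ‖t‖) ^ 2 / (2 * b) := by positivity
    have e2 : (R - b * ‖t‖) ^ 2 / (2 * b) = R ^ 2 / (2 * b) - R * ‖t‖ + b / 2 * ‖t‖ ^ 2 := by
      field_simp
      ring
    linarith

end ExpIntegrable

/-! ### The short-time Fourier transform as a Laplace transform -/

section Transform

variable {d : ℕ}

/-- The Gaussian `e^{-|x|²/2}` as a function of `(x, ξ)`. -/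
def positionGaussian (p : RSp d × RSp d) : ℂ := ((Real.exp (-‖p.1‖ ^ 2 / 2) : ℝ) : ℂ)

/-- The Gaussian is a constant times the Fourier transform of a Gaussian, that is, an integral of
e^{i⟨x,t⟩}. The bounds for exponential integrals therefore apply to it as well. -/
theorem positionGaussian_bounds : ContDiff ℝ ∞ (positionGaussian (d := d)) ∧
    ∀ K : Set (RSp d × RSp d), IsCompact K → ∃ A : ℝ, 0 ≤ A ∧
      FactorialBoundOn K 2 A positionGaussian := by
  have hc : ExpIntegrable (fun t : RSp d => ((2 * Real.pi : ℂ) ^ ((d : ℂ) / 2))⁻¹ *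
      ((Real.exp (-(1 / 2) * ‖t‖ ^ 2) : ℝ) : ℂ)) :=
    (expIntegrable_gaussian (by norm_num)).const_mul _
  have key := hc.exp_bounds positionForm
  have e : (fun p : RSp d × RSp d => ∫ t, Complex.exp (positionForm t p) *
      (((2 * Real.pi : ℂ) ^ ((d : ℂ) / 2))⁻¹ * ((Real.exp (-(1 / 2) * ‖t‖ ^ 2) : ℝ) : ℂ))) =
      positionGaussian := by
    ext p
    have h := GaussianFourier.integral_cexp_neg_mul_sq_norm_add (V := RSp d) (b := 1 / 2)
      (by norm_num) Complex.I p.1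
    rw [finrank_euclideanSpace_fin] at h
    have hπ : (2 * Real.pi : ℂ) ^ ((d : ℂ) / 2) ≠ 0 := by
      rw [Ne, Complex.cpow_eq_zero_iff]
      simp [Real.pi_ne_zero]
    calc _ = ((2 * Real.pi : ℂ) ^ ((d : ℂ) / 2))⁻¹ * ∫ t : RSp d,
          Complex.exp (-(1 / 2) * (‖t‖ : ℂ) ^ 2 + Complex.I * (inner ℝ p.1 t : ℝ)) := by
          rw [← integral_const_mul]
          congr 1
          ext t
          rw [positionForm_apply, Complex.exp_add]
          push_cast
          ring
      _ = _ := by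
          rw [h, positionGaussian]
          push_cast
          rw [show (Real.pi : ℂ) / (1 / 2) = 2 * Real.pi by ring, inv_mul_cancel_left₀ hπ,
            Complex.I_sq]
          congr 1
          ring
  rw [e] at key
  exact key

/-- The function `p ↦ e^{-|x|²/2} ∫ e^{t·z} c(t) dt`. -/
def laplaceTransform (c : RSp d → ℂ) (p : RSp d × RSp d) : ℂ :=
  positionGaussian p * ∫ t, Complex.exp (dualForm t p) * c t

theorem isGevrey_of_factorialBoundOn {E : Type} [NormedAddCommGroup E] [NormedSpace ℝ E]
    {f : E → ℂ} {s : ℝ} (hs : 1 ≤ s) {a : ℝ} (ha : 0 < a) (hf : ContDiff ℝ ∞ f)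
    (h : ∀ K : Set E, IsCompact K → ∃ A : ℝ, 0 ≤ A ∧ FactorialBoundOn K a A f) : IsGevrey s f := by
  refine ⟨hf, fun K hK => ?_⟩
  obtain ⟨A, hA, hb⟩ := h K hK
  exact ⟨a, A, ha, hA, hb.gevreyBoundOn hA ha.le hs⟩

theorem ExpIntegrable.isGevrey_laplaceTransform {c : RSp d → ℂ} (hc : ExpIntegrable c) {s : ℝ}
    (hs : 1 ≤ s) : IsGevrey s (laplaceTransform c) := by
  have h1 := positionGaussian_bounds (d := d)
  have h2 := hc.exp_bounds dualForm
  refine isGevrey_of_factorialBoundOn hs (a := 2 + 2) (by norm_num) (h1.1.mul h2.1) fun K hK => ?_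
  obtain ⟨A, hA, hb⟩ := h1.2 K hK
  obtain ⟨A', hA', hb'⟩ := h2.2 K hK
  exact ⟨A * A', by positivity, hb.mul h1.1 h2.1 zero_le_two zero_le_two hA hb'⟩

theorem gaussianWindow_sub (t x : RSp d) :
    gaussianWindow d (t - x) = gaussianWindow d t *
      ((Real.exp (inner ℝ t x) * Real.exp (-‖x‖ ^ 2 / 2) : ℝ) : ℂ) := by
  unfold gaussianWindow
  rw [← Complex.ofReal_mul, mul_assoc, ← Real.exp_add, ← Real.exp_add, norm_sub_sq_real]
  congr 3
  ring

/-- Expanding |t - x|² in the window gives φ(t) e^{⟨t,x⟩} e^{-|x|²/2}, and e^{⟨t,x⟩} joins the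
conjugated character to form e^{t·z}. Conjugation is what makes the result holomorphic in z apart
from the Gaussian in x. -/
theorem conj_stft_gaussianWindow (g : RSp d → ℂ) (p : RSp d × RSp d) :
    conj (stft (gaussianWindow d) g p) =
      laplaceTransform (fun t => conj (g t) * gaussianWindow d t) p := by
  unfold stft laplaceTransform
  rw [← integral_conj, ← integral_const_mul]
  congr 1
  ext t
  rw [gaussianWindow_sub, dualForm_eq_inner, Complex.exp_add, positionGaussian]
  simp only [map_mul, ← Complex.exp_conj, map_neg, Complex.conj_I, Complex.conj_ofReal, neg_neg,
    Complex.conj_conj]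
  push_cast
  ring

theorem expIntegrable_mul_gaussianWindow {g : RSp d → ℂ} (hg : AEStronglyMeasurable g volume)
    {C : ℝ} (hC : ∀ t, ‖g t‖ ≤ C) : ExpIntegrable (fun t => g t * gaussianWindow d t) := by
  have h : ExpIntegrable (fun t : RSp d => ((Real.pi ^ (-(d : ℝ) / 4) : ℝ) : ℂ) *
      ((Real.exp (-(1 / 2) * ‖t‖ ^ 2) : ℝ) : ℂ)) :=
    (expIntegrable_gaussian (by norm_num)).const_mul _
  have e : (fun t : RSp d => ((Real.pi ^ (-(d : ℝ) / 4) : ℝ) : ℂ) *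
      ((Real.exp (-(1 / 2) * ‖t‖ ^ 2) : ℝ) : ℂ)) = gaussianWindow d := by
    ext t
    rw [gaussianWindow, ← Complex.ofReal_mul]
    congr 3
    ring
  rw [e] at h
  refine h.of_norm_le (hg.mul h.aestronglyMeasurable) (C := C) (R := 0) fun t => ?_
  rw [norm_mul, zero_mul, Real.exp_zero, one_mul]
  gcongr
  exact hC t

end Transform


/-! ### Gevrey distributions acting on Laplace transforms -/

section Duality

variable {d : ℕ}

theorem contDiff_prod_zCoord_mul {ι : Type} (s : Finset ι) (k : ι → Fin d)
    {q : RSp d × RSp d → ℂ} (hq : ContDiff ℝ ∞ q) :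
    ContDiff ℝ ∞ (fun p => (∏ i ∈ s, zCoord (k i) p) * q p) :=
  (contDiff_prod fun i _ => (zCoord (k i)).contDiff).mul hq

theorem FactorialBoundOn.prod_zCoord_mul {ι : Type} (s : Finset ι) (k : ι → Fin d)
    {q : RSp d × RSp d → ℂ} (hq : ContDiff ℝ ∞ q) {K : Set (RSp d × RSp d)} {a A R : ℝ}
    (ha : 1 ≤ a) (hK : ∀ p ∈ K, ‖p‖ ≤ R) (h : FactorialBoundOn K a A q) :
    FactorialBoundOn K a ((2 * R + 2) ^ s.card * A)
      (fun p => (∏ i ∈ s, zCoord (k i) p) * q p) := by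
  classical
  induction s using Finset.induction_on with
  | empty => simpa using h
  | insert i s hi ih =>
    have := ih.clm_mul (contDiff_prod_zCoord_mul s k hq) ha (zCoord (k i)) (norm_zCoord_le _)
      (R := 2 * R) fun p hp => (norm_zCoord_apply_le _ p).trans (by gcongr; exact hK p hp)
    simp only [Finset.prod_insert hi, Finset.card_insert_of_notMem hi, pow_succ', mul_assoc]
    simpa only [mul_assoc] using this

variable {s : ℝ}

/-- The Gevrey function `z_{k_1} ⋯ z_{k_n} e^{-|x|²/2}`. -/
def wordFun (hs : 1 ≤ s) {n : ℕ} (k : Fin n → Fin d) : gevreySpace s (RSp d × RSp d) :=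
  ⟨fun p => (∏ i, zCoord (k i) p) * positionGaussian p,
    isGevrey_of_factorialBoundOn hs two_pos
      (contDiff_prod_zCoord_mul _ k positionGaussian_bounds.1) fun K hK => by
        obtain ⟨R, hR0, hR⟩ := hK.isBounded.exists_pos_norm_le
        obtain ⟨A, hA, hb⟩ := positionGaussian_bounds.2 K hK
        exact ⟨_, by positivity, hb.prod_zCoord_mul _ k positionGaussian_bounds.1 one_le_two hR⟩⟩

/-- The Gevrey function `e^{-|x|²/2} ∫ e^{t·z} c(t) dt`. -/
def laplaceFun (hs : 1 ≤ s) {c : RSp d → ℂ} (hc : ExpIntegrable c) :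
    gevreySpace s (RSp d × RSp d) :=
  ⟨laplaceTransform c, hc.isGevrey_laplaceTransform hs⟩

/-- The terms of the expansion of `F(e^{t·z} e^{-|x|²/2})` in powers of `t`. -/
def dualTerm (hs : 1 ≤ s) (F : Module.Dual ℂ (gevreySpace s (RSp d × RSp d))) (n : ℕ)
    (t : RSp d) : ℂ :=
  ∑ k : Fin n → Fin d, (∏ i, (t (k i) : ℂ)) * (F (wordFun hs k) / (n ! : ℂ))

theorem sum_words_prod_abs_le (n : ℕ) (t : RSp d) :
    ∑ k : Fin n → Fin d, ∏ i, |t (k i)| ≤ (d * ‖t‖) ^ n := by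
  rw [← Fintype.sum_pow (fun j => |t j|) n]
  gcongr
  calc ∑ j, |t j| ≤ ∑ _j : Fin d, ‖t‖ := Finset.sum_le_sum fun j _ => PiLp.norm_apply_le t j
    _ = _ := by simp

theorem continuous_prod_word {n : ℕ} (k : Fin n → Fin d) :
    Continuous (fun t : RSp d => ∏ i, (t (k i) : ℂ)) :=
  continuous_finsetProd _ fun i _ =>
    Complex.continuous_ofReal.comp (EuclideanSpace.proj (𝕜 := ℝ) (k i)).continuous

theorem ExpIntegrable.word_mul {c : RSp d → ℂ} (hc : ExpIntegrable c) {n : ℕ}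
    (k : Fin n → Fin d) : ExpIntegrable (fun t => (∏ i, (t (k i) : ℂ)) * c t) := by
  refine hc.of_norm_le ((continuous_prod_word k).aestronglyMeasurable.mul hc.aestronglyMeasurable)
    (C := (n ! : ℝ)) (R := 1) fun t => ?_
  rw [norm_mul, ← mul_assoc, one_mul]
  gcongr
  rw [norm_prod]
  have h := Real.pow_div_factorial_le_exp ‖t‖ (norm_nonneg _) n
  rw [div_le_iff₀ (by positivity)] at h
  calc ∏ i, ‖(t (k i) : ℂ)‖ ≤ ∏ _i : Fin n, ‖t‖ := Finset.prod_le_prod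
        (fun _ _ => norm_nonneg _) fun i _ => by
          rw [Complex.norm_real]; exact PiLp.norm_apply_le t (k i)
    _ = ‖t‖ ^ n := by simp
    _ ≤ _ := by linarith

theorem ExpIntegrable.integrable_self {c : RSp d → ℂ} (hc : ExpIntegrable c) :
    Integrable c volume := by
  have := hc.integrable 0
  simp only [zero_mul, Real.exp_zero, one_mul] at this
  exact (integrable_norm_iff hc.aestronglyMeasurable).1 this

/-- Taylor expansion of e^{t·z} under the integral. Writing (t·z)^n as a sum over words in the
letters 1, …, d separates t from z without multinomial coefficients. -/
theorem laplaceTransform_eq_sum_add {c : RSp d → ℂ} (hc : ExpIntegrable c) (N : ℕ)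
    (p : RSp d × RSp d) :
    laplaceTransform c p = (∑ n ∈ Finset.range N, ∑ k : Fin n → Fin d,
      ((∫ t, (∏ i, (t (k i) : ℂ)) * c t) / (n ! : ℂ)) *
        ((∏ i, zCoord (k i) p) * positionGaussian p)) +
      positionGaussian p * ∫ t, expTail N (dualForm t p) * c t := by
  have hterm : ∀ n, Integrable (fun t => (dualForm t p) ^ n / (n ! : ℂ) * c t) ∧
      ∫ t, (dualForm t p) ^ n / (n ! : ℂ) * c t = ∑ k : Fin n → Fin d,
      ((∫ t, (∏ i, (t (k i) : ℂ)) * c t) / (n ! : ℂ)) * ∏ i, zCoord (k i) p := by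
    intro n
    have e : (fun t => (dualForm t p) ^ n / (n ! : ℂ) * c t) = fun t =>
        ∑ k : Fin n → Fin d, (∏ i, (t (k i) : ℂ)) * c t *
          ((∏ i, zCoord (k i) p) / (n ! : ℂ)) := by
      ext t
      rw [dualForm_apply, Fintype.sum_pow, Finset.sum_div, Finset.sum_mul]
      refine Finset.sum_congr rfl fun k _ => ?_
      rw [Finset.prod_mul_distrib]
      ring
    have hi : ∀ k : Fin n → Fin d, Integrable (fun t : RSp d => (∏ i, (t (k i) : ℂ)) * c t *
          ((∏ i, zCoord (k i) p) / (n ! : ℂ))) := fun k =>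
      (hc.word_mul k).integrable_self.mul_const _
    rw [e]
    refine ⟨integrable_finsetSum _ fun k _ => hi k, ?_⟩
    rw [integral_finsetSum _ fun k _ => hi k]
    refine Finset.sum_congr rfl fun k _ => ?_
    rw [integral_mul_const]
    ring
  have hsub : ∫ t, expTail N (dualForm t p) * c t = (∫ t, Complex.exp (dualForm t p) * c t) -
      ∑ n ∈ Finset.range N, ∫ t, (dualForm t p) ^ n / (n ! : ℂ) * c t := by
    rw [← integral_finsetSum _ fun n _ => (hterm n).1, ← integral_sub
      (hc.integrable_exp_mul dualForm p) (integrable_finsetSum _ fun n _ => (hterm n).1)]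
    congr 1
    ext t
    rw [expTail, sub_mul, Finset.sum_mul]
  rw [hsub, laplaceTransform, mul_sub, Finset.mul_sum]
  simp only [fun n => (hterm n).2, Finset.mul_sum]
  rw [← sub_eq_iff_eq_add']
  congr 1
  · refine Finset.sum_congr rfl fun n _ => Finset.sum_congr rfl fun k _ => ?_
    ring

theorem norm_apply_le_of_factorialBoundOn (hs : 1 ≤ s)
    {F : Module.Dual ℂ (gevreySpace s (RSp d × RSp d))} {K : Set (RSp d × RSp d)} {a C : ℝ}
    (ha : 0 ≤ a)
    (hC : ∀ (f : gevreySpace s (RSp d × RSp d)) (M : ℝ), 0 ≤ M →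
      GevreyBoundOn s K a M (f : RSp d × RSp d → ℂ) → ‖F f‖ ≤ C * M)
    (G : gevreySpace s (RSp d × RSp d)) {q : RSp d × RSp d → ℂ}
    (hG : (G : RSp d × RSp d → ℂ) = q) {A : ℝ} (hA : 0 ≤ A) (h : FactorialBoundOn K a A q) :
    ‖F G‖ ≤ C * A :=
  hC G A hA (by rw [hG]; exact h.gevreyBoundOn hA ha hs)

/-- One continuity estimate of F, at rate 2, serves all word lengths, since multiplying by a
coordinate preserves the rate and costs the factor 2R + 2, with R bounding the norm on K. -/
theorem exists_norm_apply_wordFun_le (hs : 1 ≤ s)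
    {F : Module.Dual ℂ (gevreySpace s (RSp d × RSp d))} (hF : F ∈ gevreyDual s (RSp d × RSp d)) :
    ∃ D R : ℝ, 0 ≤ D ∧ 0 ≤ R ∧ ∀ {n : ℕ} (k : Fin n → Fin d), ‖F (wordFun hs k)‖ ≤ D * R ^ n := by
  obtain ⟨K, hK, hF⟩ := hF
  obtain ⟨C, hC⟩ := hF 2 two_pos
  obtain ⟨R, hR0, hR⟩ := hK.isBounded.exists_pos_norm_le
  obtain ⟨A, hA, hb⟩ := positionGaussian_bounds.2 K hK
  refine ⟨|C| * A, 2 * R + 2, by positivity, by positivity, fun {n} k => ?_⟩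
  refine (norm_apply_le_of_factorialBoundOn hs zero_le_two hC (wordFun hs k) rfl (by positivity)
    (hb.prod_zCoord_mul Finset.univ k positionGaussian_bounds.1 one_le_two hR)).trans ?_
  rw [Finset.card_univ, Fintype.card_fin]
  calc _ ≤ |C| * ((2 * R + 2) ^ n * A) := by
        gcongr
        exact le_abs_self _
    _ = _ := by ring

theorem continuous_dualTerm (hs : 1 ≤ s) (F : Module.Dual ℂ (gevreySpace s (RSp d × RSp d)))
    (n : ℕ) : Continuous (dualTerm hs F n) :=
  continuous_finsetSum _ fun k _ => (continuous_prod_word k).mul continuous_const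

theorem norm_dualTerm_le (hs : 1 ≤ s)
    {F : Module.Dual ℂ (gevreySpace s (RSp d × RSp d))} {D R : ℝ} (hD : 0 ≤ D) (hR : 0 ≤ R)
    (hword : ∀ {n : ℕ} (k : Fin n → Fin d), ‖F (wordFun hs k)‖ ≤ D * R ^ n) (n : ℕ) (t : RSp d) :
    ‖dualTerm hs F n t‖ ≤ D * ((R * d * ‖t‖) ^ n / (n ! : ℝ)) := by
  unfold dualTerm
  calc _ ≤ ∑ k : Fin n → Fin d, (∏ i, |t (k i)|) * (D * R ^ n / (n ! : ℝ)) := by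
        refine norm_sum_le_of_le _ fun k _ => ?_
        rw [norm_mul, norm_div, Complex.norm_natCast, norm_prod]
        simp only [Complex.norm_real, Real.norm_eq_abs]
        gcongr
        exact hword k
    _ ≤ (d * ‖t‖) ^ n * (D * R ^ n / (n ! : ℝ)) := by
        rw [← Finset.sum_mul]
        gcongr
        exact sum_words_prod_abs_le n t
    _ = _ := by ring

theorem integral_dualTerm_mul (hs : 1 ≤ s) (F : Module.Dual ℂ (gevreySpace s (RSp d × RSp d)))
    {c : RSp d → ℂ} (hc : ExpIntegrable c) (n : ℕ) :
    ∫ t, dualTerm hs F n t * c t = ∑ k : Fin n → Fin d,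
      ((∫ t, (∏ i, (t (k i) : ℂ)) * c t) / (n ! : ℂ)) * F (wordFun hs k) := by
  have hi : ∀ k : Fin n → Fin d, Integrable (fun t : RSp d => (∏ i, (t (k i) : ℂ)) * c t *
        (F (wordFun hs k) / (n ! : ℂ))) := fun k =>
    (hc.word_mul k).integrable_self.mul_const _
  calc _ = ∫ t, ∑ k : Fin n → Fin d, (∏ i, (t (k i) : ℂ)) * c t *
        (F (wordFun hs k) / (n ! : ℂ)) := by
        congr 1
        ext t
        rw [dualTerm, Finset.sum_mul]
        exact Finset.sum_congr rfl fun k _ => by ring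
    _ = _ := by
        rw [integral_finsetSum _ fun k _ => hi k]
        refine Finset.sum_congr rfl fun k _ => ?_
        rw [integral_mul_const]
        ring

/-- The difference is F applied to the Gaussian times a Taylor remainder. That product has rate 2 +
2 for every N and a constant decaying like 2^{-N}, so one continuity estimate of F suffices. -/
theorem exists_norm_apply_laplaceFun_sub_le (hs : 1 ≤ s)
    {F : Module.Dual ℂ (gevreySpace s (RSp d × RSp d))} (hF : F ∈ gevreyDual s (RSp d × RSp d))
    {c : RSp d → ℂ} (hc : ExpIntegrable c) :
    ∃ C : ℝ, ∀ N, ‖F (laplaceFun hs hc) - ∑ n ∈ Finset.range N, ∫ t, dualTerm hs F n t * c t‖ ≤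
      C * (1 / 2) ^ N := by
  obtain ⟨K, hK, hF⟩ := hF
  obtain ⟨C, hC⟩ := hF (2 + 2) (by norm_num)
  obtain ⟨R, hR0, hR⟩ := hK.isBounded.exists_pos_norm_le
  obtain ⟨A, hA, hb⟩ := positionGaussian_bounds.2 K hK
  set I := ∫ t, Real.exp ((2 * R + 1) * ‖dualForm t‖) * ‖c t‖ with hI
  have hI0 : 0 ≤ I := integral_nonneg fun t => by positivity
  refine ⟨C * (A * I), fun N => ?_⟩
  have htail := hc.expTail_bounds dualForm N hR
  have e : F (laplaceFun hs hc) - ∑ n ∈ Finset.range N, ∫ t, dualTerm hs F n t * c t =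
      F (laplaceFun hs hc - ∑ n ∈ Finset.range N, ∑ k : Fin n → Fin d,
        ((∫ t, (∏ i, (t (k i) : ℂ)) * c t) / (n ! : ℂ)) • wordFun hs k) := by
    rw [map_sub, map_sum]
    congr 1
    refine Finset.sum_congr rfl fun n _ => ?_
    rw [integral_dualTerm_mul hs F hc, map_sum]
    exact Finset.sum_congr rfl fun k _ => by rw [map_smul, smul_eq_mul]
  have e2 : ((laplaceFun hs hc - ∑ n ∈ Finset.range N, ∑ k : Fin n → Fin d,
        ((∫ t, (∏ i, (t (k i) : ℂ)) * c t) / (n ! : ℂ)) • wordFun hs k :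
        gevreySpace s (RSp d × RSp d)) : RSp d × RSp d → ℂ) =
      fun p => positionGaussian p * ∫ t, expTail N (dualForm t p) * c t := by
    ext p
    have := laplaceTransform_eq_sum_add hc N p
    simp only [Submodule.coe_sub, Submodule.coe_sum, Submodule.coe_smul, Pi.sub_apply,
      Finset.sum_apply, Pi.smul_apply, smul_eq_mul, laplaceFun, wordFun]
    rw [this, add_sub_cancel_left]
  rw [e]
  refine (norm_apply_le_of_factorialBoundOn hs (by norm_num) hC _ e2 (by positivity)
    (hb.mul positionGaussian_bounds.1 htail.1 zero_le_two zero_le_two hA htail.2)).trans_eq ?_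
  ring

/-- A Gevrey distribution acts on `e^{-|x|²/2} ∫ e^{t·z} c(t) dt` by integration of `c` against
a function of exponential growth. -/
theorem exists_density_of_mem_gevreyDual (hs : 1 ≤ s)
    {F : Module.Dual ℂ (gevreySpace s (RSp d × RSp d))} (hF : F ∈ gevreyDual s (RSp d × RSp d)) :
    ∃ (P : RSp d → ℂ) (C S : ℝ), AEStronglyMeasurable P volume ∧
      (∀ t, ‖P t‖ ≤ C * Real.exp (S * ‖t‖)) ∧
      ∀ (c : RSp d → ℂ) (hc : ExpIntegrable c), F (laplaceFun hs hc) = ∫ t, P t * c t := by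
  obtain ⟨D, R, hD, hR, hword⟩ := exists_norm_apply_wordFun_le hs hF
  set S := R * d with hS
  have hterm := norm_dualTerm_le hs hD hR hword
  rw [← hS] at hterm
  have hexp : ∀ t : RSp d, HasSum (fun n : ℕ => D * ((S * ‖t‖) ^ n / (n ! : ℝ)))
      (D * Real.exp (S * ‖t‖)) := fun t => by
    rw [Real.exp_eq_exp_ℝ]
    exact (NormedSpace.expSeries_div_hasSum_exp (S * ‖t‖)).mul_left D
  have hsum : ∀ t, Summable (fun n => dualTerm hs F n t) := fun t =>
    Summable.of_norm_bounded (hexp t).summable fun n => hterm n t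
  have hcont := continuous_dualTerm hs F
  have hmeas : AEStronglyMeasurable (fun t => ∑' n, dualTerm hs F n t) volume :=
    aestronglyMeasurable_of_tendsto_ae Filter.atTop
      (f := fun N t => ∑ n ∈ Finset.range N, dualTerm hs F n t)
      (fun N => (continuous_finsetSum _ fun n _ => hcont n).aestronglyMeasurable)
      (Filter.Eventually.of_forall fun t => (hsum t).hasSum.tendsto_sum_nat)
  refine ⟨fun t => ∑' n, dualTerm hs F n t, D, S, hmeas,
    fun t => tsum_of_norm_bounded (hexp t) fun n => hterm n t, fun c hc => ?_⟩
  have hbnd : Integrable (fun t => D * Real.exp (S * ‖t‖) * ‖c t‖) := by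
    simpa only [mul_assoc] using (hc.integrable S).const_mul D
  -- The same partial sums have two limits: the integral, by dominated convergence, and the value of
  -- F, by its continuity on the remainders.
  have hlim1 : Filter.Tendsto (fun N => ∑ n ∈ Finset.range N, ∫ t, dualTerm hs F n t * c t)
      Filter.atTop (nhds (∫ t, (∑' n, dualTerm hs F n t) * c t)) := by
    have hDi : ∀ n, Integrable (fun t => dualTerm hs F n t * c t) := fun n => by
      refine hbnd.mono' ((hcont n).aestronglyMeasurable.mul hc.aestronglyMeasurable)
        (Filter.Eventually.of_forall fun t => ?_)
      rw [norm_mul]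
      gcongr
      exact (hterm n t).trans (le_hasSum (hexp t) n fun m _ => by positivity)
    simp_rw [← integral_finsetSum _ fun n _ => hDi n]
    refine tendsto_integral_of_dominated_convergence
      (F := fun N t => ∑ n ∈ Finset.range N, dualTerm hs F n t * c t)
      (fun t => D * Real.exp (S * ‖t‖) * ‖c t‖)
      (fun N => (continuous_finsetSum (Finset.range N) fun n _ => hcont n).aestronglyMeasurable.mul
        hc.aestronglyMeasurable |>.congr (Filter.Eventually.of_forall fun t => by
          simp [Finset.sum_mul])) hbnd (fun N => Filter.Eventually.of_forall fun t => ?_)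
      (Filter.Eventually.of_forall fun t => ?_)
    · rw [← Finset.sum_mul, norm_mul]
      gcongr
      refine (norm_sum_le_of_le _ fun n _ => hterm n t).trans ?_
      exact sum_le_hasSum _ (fun m _ => by positivity) (hexp t)
    · simp_rw [← Finset.sum_mul]
      exact (hsum t).hasSum.tendsto_sum_nat.mul_const _
  have hlim2 : Filter.Tendsto (fun N => ∑ n ∈ Finset.range N, ∫ t, dualTerm hs F n t * c t)
      Filter.atTop (nhds (F (laplaceFun hs hc))) := by
    obtain ⟨C, hC⟩ := exists_norm_apply_laplaceFun_sub_le hs hF hc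
    rw [tendsto_iff_norm_sub_tendsto_zero]
    have h0 : Filter.Tendsto (fun N : ℕ => C * (1 / 2 : ℝ) ^ N) Filter.atTop (nhds 0) := by
      simpa using (tendsto_pow_atTop_nhds_zero_of_lt_one (r := (1 / 2 : ℝ)) (by norm_num)
        (by norm_num)).const_mul C
    refine squeeze_zero (fun _ => norm_nonneg _) (fun N => ?_) h0
    rw [norm_sub_rev]
    exact hC N
  exact tendsto_nhds_unique hlim2 hlim1

end Duality


/-! ### Derivatives of the Gaussian in one variable -/

section GaussianDerivatives

open Polynomial in
/-- The polynomials `p_n` with `(d/dt)^n e^{-t²} = p_n(t) e^{-t²}`. -/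
def gaussPoly : ℕ → ℝ[X]
  | 0 => 1
  | n + 1 => derivative (gaussPoly n) - C 2 * X * gaussPoly n

theorem degree_gaussPoly (n : ℕ) : (gaussPoly n).degree = n := by
  induction n with
  | zero => simp [gaussPoly]
  | succ n ih =>
    rw [gaussPoly]
    have h1 : (Polynomial.C (2 : ℝ) * Polynomial.X * gaussPoly n).degree = ((n + 1 : ℕ) : WithBot ℕ) := by
      rw [Polynomial.degree_mul, Polynomial.degree_C_mul_X two_ne_zero, ih]
      push_cast
      exact add_comm _ _
    rw [Polynomial.degree_sub_eq_right_of_degree_lt, h1]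
    rw [h1]
    refine (Polynomial.degree_derivative_le).trans_lt ?_
    rw [ih]
    exact_mod_cast n.lt_succ_self

/-- The `n`-th derivative of `e^{-t²}`. -/
def gaussDeriv (n : ℕ) : ℝ → ℝ := iteratedDeriv n (fun t : ℝ => Real.exp (-t ^ 2))

theorem gaussDeriv_eq (n : ℕ) : gaussDeriv n = fun t => (gaussPoly n).eval t * Real.exp (-t ^ 2) := by
  induction n with
  | zero => ext t; simp [gaussDeriv, gaussPoly]
  | succ n ih =>
    ext t
    rw [gaussDeriv, iteratedDeriv_succ]
    change deriv (gaussDeriv n) t = _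
    rw [ih]
    have h : HasDerivAt (fun t => (gaussPoly n).eval t * Real.exp (-t ^ 2))
        ((gaussPoly n).derivative.eval t * Real.exp (-t ^ 2) +
          (gaussPoly n).eval t * (Real.exp (-t ^ 2) * (-(2 * t)))) t := by
      refine ((gaussPoly n).hasDerivAt t).mul (HasDerivAt.exp ?_)
      simpa using (hasDerivAt_pow 2 t).fun_neg
    rw [h.deriv, gaussPoly]
    simp
    ring

theorem hasDerivAt_gaussDeriv (n : ℕ) (t : ℝ) :
    HasDerivAt (gaussDeriv n) (gaussDeriv (n + 1) t) t := by
  have h : gaussDeriv (n + 1) t = deriv (gaussDeriv n) t := by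
    rw [gaussDeriv, iteratedDeriv_succ]; rfl
  rw [h, hasDerivAt_deriv_iff, gaussDeriv_eq]
  exact (gaussPoly n).differentiable.differentiableAt.mul (by fun_prop)

theorem continuous_gaussDeriv (n : ℕ) : Continuous (gaussDeriv n) :=
  continuous_iff_continuousAt.2 fun t => (hasDerivAt_gaussDeriv n t).continuousAt

theorem Polynomial.exists_abs_eval_le_exp (p : Polynomial ℝ) :
    ∃ C : ℝ, 0 ≤ C ∧ ∀ t : ℝ, |p.eval t| ≤ C * Real.exp |t| := by
  induction p using Polynomial.induction_on' with
  | add p q hp hq =>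
    obtain ⟨C, hC, h⟩ := hp
    obtain ⟨C', hC', h'⟩ := hq
    refine ⟨C + C', by positivity, fun t => ?_⟩
    rw [Polynomial.eval_add, add_mul]
    exact (abs_add_le _ _).trans (add_le_add (h t) (h' t))
  | monomial n a =>
    refine ⟨|a| * (n ! : ℝ), by positivity, fun t => ?_⟩
    have h := Real.pow_div_factorial_le_exp |t| (abs_nonneg _) n
    rw [div_le_iff₀ (by positivity)] at h
    rw [Polynomial.eval_monomial, abs_mul, abs_pow, mul_assoc]
    gcongr
    linarith

theorem exists_abs_gaussDeriv_le (n : ℕ) :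
    ∃ C : ℝ, 0 ≤ C ∧ ∀ t : ℝ, |gaussDeriv n t| ≤ C * (Real.exp |t| * Real.exp (-t ^ 2)) := by
  obtain ⟨C, hC, h⟩ := (gaussPoly n).exists_abs_eval_le_exp
  refine ⟨C, hC, fun t => ?_⟩
  rw [gaussDeriv_eq, abs_mul, abs_of_pos (Real.exp_pos (-t ^ 2)), ← mul_assoc]
  gcongr
  exact h t

theorem integrable_gaussDeriv_mul_cexp (n : ℕ) (z : ℂ) :
    Integrable (fun t : ℝ => (gaussDeriv n t : ℂ) * Complex.exp (t * z)) := by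
  obtain ⟨C, hC, h⟩ := exists_abs_gaussDeriv_le n
  set R := 1 + ‖z‖
  refine ((integrable_exp_neg_mul_sq (b := 1 / 2) (by norm_num)).const_mul
    (C * Real.exp (R ^ 2 / 2))).mono' ?_ (Filter.Eventually.of_forall fun t => ?_)
  · exact ((Complex.continuous_ofReal.comp (continuous_gaussDeriv n)).mul
      (by fun_prop)).aestronglyMeasurable
  · rw [norm_mul, Complex.norm_real, Real.norm_eq_abs]
    have h2 : ‖Complex.exp (t * z)‖ ≤ Real.exp (|t| * ‖z‖) := by
      refine (Complex.norm_exp_le_exp_norm _).trans ?_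
      rw [norm_mul, Complex.norm_real, Real.norm_eq_abs]
    calc _ ≤ C * (Real.exp |t| * Real.exp (-t ^ 2)) * Real.exp (|t| * ‖z‖) := by
          gcongr
          exact h t
      _ = C * Real.exp (R * |t| - t ^ 2) := by
          rw [mul_assoc, ← Real.exp_add, ← Real.exp_add]
          congr 2
          ring
      _ ≤ C * Real.exp (R ^ 2 / 2 + -(1 / 2) * t ^ 2) := by
          gcongr
          nlinarith [sq_nonneg (R - |t|), sq_abs t]
      _ = _ := by rw [Real.exp_add, mul_assoc]

/-- Each integration by parts moves one derivative onto e^{tz} and produces a factor -z; the case n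
= 0 is the Gaussian integral. -/
theorem integral_gaussDeriv_mul_cexp (n : ℕ) (z : ℂ) :
    ∫ t : ℝ, (gaussDeriv n t : ℂ) * Complex.exp (t * z) =
      (-z) ^ n * ((Real.pi : ℂ) ^ (1 / 2 : ℂ) * Complex.exp (z ^ 2 / 4)) := by
  induction n with
  | zero =>
    have h := integral_cexp_quadratic (b := -1) (by norm_num) z 0
    rw [pow_zero, one_mul]
    convert h using 1
    · congr 1
      ext t
      simp only [gaussDeriv, iteratedDeriv_zero]
      push_cast
      rw [← Complex.exp_add]
      congr 1
      ring
    · congr 2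
      · simp
      · ring
  | succ n ih =>
    have hv : ∀ t : ℝ, HasDerivAt (fun t : ℝ => (gaussDeriv n t : ℂ))
        ((gaussDeriv (n + 1) t : ℝ) : ℂ) t := fun t => (hasDerivAt_gaussDeriv n t).ofReal_comp
    have hu : ∀ t : ℝ, HasDerivAt (fun t : ℝ => Complex.exp (t * z)) (Complex.exp (t * z) * z) t :=
      fun t => by
        have : HasDerivAt (fun t : ℝ => (t : ℂ) * z) z t := by
          simpa using (Complex.ofRealCLM.hasDerivAt (x := t)).mul_const z
        exact this.cexp
    have key := integral_mul_deriv_eq_deriv_mul_of_integrable (fun t _ => hu t) (fun t _ => hv t)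
      ((integrable_gaussDeriv_mul_cexp (n + 1) z).congr (Filter.Eventually.of_forall fun t => by
        simp only [Pi.mul_apply]; ring))
      (((integrable_gaussDeriv_mul_cexp n z).mul_const z).congr
        (Filter.Eventually.of_forall fun t => by simp only [Pi.mul_apply]; ring))
      ((integrable_gaussDeriv_mul_cexp n z).congr (Filter.Eventually.of_forall fun t => by
        simp only [Pi.mul_apply]; ring))
    calc _ = ∫ t : ℝ, Complex.exp (t * z) * (gaussDeriv (n + 1) t : ℂ) := by simp only [mul_comm]
      _ = -∫ t : ℝ, (gaussDeriv n t : ℂ) * Complex.exp (t * z) * z := by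
          rw [key]
          congr 2
          ext t
          ring
      _ = _ := by
          rw [integral_mul_const, ih]
          ring

end GaussianDerivatives

/-! ### Transforms of Hermite functions -/

section HermiteFunctions

variable {d : ℕ}

/-- The constant `(2^{|α|} α!)^{-1/2}`. -/
def hermiteNorm (α : Fin d → ℕ) : ℝ :=
  ((2 : ℝ) ^ (∑ j, α j) * ∏ j, ((α j)! : ℝ)) ^ (-(1 / 2) : ℝ)

theorem hermiteNorm_pos (α : Fin d → ℕ) : 0 < hermiteNorm α := by
  unfold hermiteNorm
  have : 0 < ∏ j, ((α j)! : ℝ) := Finset.prod_pos fun j _ => by positivity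
  positivity

theorem integral_prod_gaussDeriv_mul_cexp (α : Fin d → ℕ) (w : Fin d → ℂ) :
    ∫ t : RSp d, (∏ j, (gaussDeriv (α j) (t j) : ℂ)) * Complex.exp (∑ j, (t j : ℂ) * w j) =
      (∏ j, (-w j) ^ α j) * ((Real.pi : ℂ) ^ (d / 2 : ℂ) * Complex.exp ((∑ j, w j ^ 2) / 4)) := by
  have h := (EuclideanSpace.volume_preserving_symm_measurableEquiv_toLp (Fin d)).integral_comp
    (MeasurableEquiv.measurableEmbedding _) (fun t : Fin d → ℝ =>
      ∏ j, ((gaussDeriv (α j) (t j) : ℂ) * Complex.exp ((t j : ℂ) * w j)))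
  rw [integral_fintype_prod_volume_eq_prod (fun (j : Fin d) (t : ℝ) =>
    (gaussDeriv (α j) t : ℂ) * Complex.exp ((t : ℂ) * w j))] at h
  simp only [integral_gaussDeriv_mul_cexp, Finset.prod_mul_distrib, ← Complex.exp_sum,
    ← Finset.sum_div] at h
  rw [Finset.prod_const, Finset.card_univ, Fintype.card_fin, ← Complex.cpow_nat_mul] at h
  have e : (d / 2 : ℂ) = d * (1 / 2) := by ring
  rw [e]
  exact h

/-- The product `h_α φ`. -/
def hermiteWindow (α : Fin d → ℕ) (t : RSp d) : ℂ := (hermiteFun α t : ℂ) * gaussianWindow d t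

theorem hermiteWindow_eq (α : Fin d → ℕ) (t : RSp d) :
    hermiteWindow α t = ((Real.pi ^ (-(d : ℝ) / 2) * (-1) ^ (∑ j, α j) * hermiteNorm α : ℝ) : ℂ) *
      ∏ j, (gaussDeriv (α j) (t j) : ℂ) := by
  have hπ : Real.pi ^ (-(d : ℝ) / 2) = Real.pi ^ (-(d : ℝ) / 4) * Real.pi ^ (-(d : ℝ) / 4) := by
    rw [← Real.rpow_add Real.pi_pos]
    congr 1
    ring
  have he : Real.exp (‖t‖ ^ 2 / 2) * Real.exp (-‖t‖ ^ 2 / 2) = 1 := by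
    rw [← Real.exp_add]
    simp [neg_div]
  rw [hermiteWindow, gaussianWindow, hπ, hermiteFun, ← Complex.ofReal_prod, ← Complex.ofReal_mul,
    ← Complex.ofReal_mul]
  congr 1
  change Real.pi ^ (-(d : ℝ) / 4) * (-1) ^ (∑ j, α j) * hermiteNorm α * Real.exp (‖t‖ ^ 2 / 2) *
    (∏ j, gaussDeriv (α j) (t j)) * (Real.pi ^ (-(d : ℝ) / 4) * Real.exp (-‖t‖ ^ 2 / 2)) = _
  linear_combination (Real.pi ^ (-(d : ℝ) / 4) * (-1) ^ (∑ j, α j) * hermiteNorm α *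
    (∏ j, gaussDeriv (α j) (t j)) * Real.pi ^ (-(d : ℝ) / 4)) * he

theorem expIntegrable_prod_of_abs_le {u : Fin d → ℝ → ℝ} (hu : ∀ j, Continuous (u j)) {b : ℝ}
    (hb : 0 < b)
    (h : ∀ j, ∃ C : ℝ, 0 ≤ C ∧ ∀ t, |u j t| ≤ C * (Real.exp |t| * Real.exp (-b * t ^ 2))) :
    ExpIntegrable (fun t : RSp d => ∏ j, (u j (t j) : ℂ)) := by
  choose C hC h using h
  refine (expIntegrable_gaussian hb).of_norm_le ?_ (C := ∏ j, C j) (R := d) fun t => ?_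
  · exact (continuous_finsetProd _ fun j _ => Complex.continuous_ofReal.comp ((hu j).comp
      (EuclideanSpace.proj (𝕜 := ℝ) j).continuous)).aestronglyMeasurable
  · rw [norm_prod]
    simp only [Complex.norm_real, Real.norm_eq_abs, abs_of_pos (Real.exp_pos _)]
    refine (Finset.prod_le_prod (fun _ _ => abs_nonneg _) fun j _ => h j (t j)).trans ?_
    rw [Finset.prod_mul_distrib, Finset.prod_mul_distrib, ← Real.exp_sum, ← Real.exp_sum,
      EuclideanSpace.norm_sq_eq, Finset.mul_sum]
    simp only [Real.norm_eq_abs, sq_abs]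
    gcongr
    · exact Finset.prod_nonneg fun j _ => hC j
    · calc ∑ j, |t j| ≤ ∑ _j : Fin d, ‖t‖ :=
            Finset.sum_le_sum fun j _ => PiLp.norm_apply_le t j
        _ = _ := by simp

theorem expIntegrable_hermiteWindow (α : Fin d → ℕ) : ExpIntegrable (hermiteWindow α) := by
  have h := (expIntegrable_prod_of_abs_le (fun j => continuous_gaussDeriv (α j)) one_pos fun j => by
    simpa using exists_abs_gaussDeriv_le (α j)).const_mul
      ((Real.pi ^ (-(d : ℝ) / 2) * (-1) ^ (∑ j, α j) * hermiteNorm α : ℝ) : ℂ)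
  have e : hermiteWindow α = _ := funext (hermiteWindow_eq α)
  rw [e]
  exact h

/-- The window cancels the growing Gaussian in h_α, so h_α φ is a multiple of ∂^α e^{-|t|²}. Its
Laplace transform contains (-z)^α, and these signs cancel against the (-1)^{|α|} in h_α. -/
theorem laplaceTransform_hermiteWindow (α : Fin d → ℕ) (p : RSp d × RSp d) :
    laplaceTransform (hermiteWindow α) p = (hermiteNorm α : ℂ) * (∏ j, zCoord j p ^ α j) *
      (positionGaussian p * Complex.exp ((∑ j, zCoord j p ^ 2) / 4)) := by
  have hπ : (((Real.pi ^ (-(d : ℝ) / 2) : ℝ)) : ℂ) * (Real.pi : ℂ) ^ (d / 2 : ℂ) = 1 := by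
    rw [Complex.ofReal_cpow Real.pi_pos.le, ← Complex.cpow_add _ _ (by simp [Real.pi_ne_zero])]
    push_cast
    rw [neg_div, neg_add_cancel, Complex.cpow_zero]
  have hs : ((-1 : ℂ)) ^ (∑ j, α j) * ∏ j, (-zCoord j p) ^ α j = ∏ j, zCoord j p ^ α j := by
    rw [← Finset.prod_pow_eq_pow_sum, ← Finset.prod_mul_distrib]
    exact Finset.prod_congr rfl fun j _ => by rw [← mul_pow]; simp
  have hi : ∫ t, Complex.exp (dualForm t p) * hermiteWindow α t =
      ((Real.pi ^ (-(d : ℝ) / 2) * (-1) ^ (∑ j, α j) * hermiteNorm α : ℝ) : ℂ) *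
      ((∏ j, (-zCoord j p) ^ α j) * ((Real.pi : ℂ) ^ (d / 2 : ℂ) *
        Complex.exp ((∑ j, zCoord j p ^ 2) / 4))) := by
    rw [← integral_prod_gaussDeriv_mul_cexp, ← integral_const_mul]
    congr 1
    ext t
    rw [hermiteWindow_eq, dualForm_apply]
    ring
  rw [laplaceTransform, hi, ← hs]
  push_cast

  linear_combination (positionGaussian p * (-1) ^ (∑ j, α j) * (hermiteNorm α : ℂ) *
    (∏ j, (-zCoord j p) ^ α j) * Complex.exp ((∑ j, zCoord j p ^ 2) / 4)) * hπ

theorem hermiteNorm_zero : hermiteNorm (0 : Fin d → ℕ) = 1 := by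
  simp [hermiteNorm]

theorem prod_sigma_range_zCoord (α : Fin d → ℕ) (p : RSp d × RSp d) :
    ∏ i ∈ Finset.univ.sigma (fun j => Finset.range (α j)), zCoord i.1 p = ∏ j, zCoord j p ^ α j := by
  rw [Finset.prod_sigma]
  simp

/-- After division by `hermiteNorm α`, the transform of h_α is z^α times that of h_0. Only the |α|
coordinate factors depend on α, and each costs the fixed factor R. This gives the decay of the
Hermite coefficients. -/
theorem exists_norm_apply_hermite_le {s : ℝ} (hs : 1 ≤ s)
    {F : Module.Dual ℂ (gevreySpace s (RSp d × RSp d))} (hF : F ∈ gevreyDual s (RSp d × RSp d)) :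
    ∃ C R : ℝ, 0 < R ∧ ∀ α : Fin d → ℕ, ‖F (laplaceFun hs (expIntegrable_hermiteWindow α))‖ ≤
      C * (R ^ (∑ j, α j) * hermiteNorm α) := by
  obtain ⟨K, hK, hF⟩ := hF
  obtain ⟨C, hC⟩ := hF (2 + 2) (by norm_num)
  obtain ⟨R, hR0, hR⟩ := hK.isBounded.exists_pos_norm_le
  have hq := (expIntegrable_hermiteWindow (d := d) 0).exp_bounds dualForm
  obtain ⟨A, hA, hb⟩ := positionGaussian_bounds.2 K hK
  obtain ⟨A', hA', hb'⟩ := hq.2 K hK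
  have hsm := (positionGaussian_bounds (d := d)).1.mul hq.1
  have hbd := hb.mul positionGaussian_bounds.1 hq.1 zero_le_two zero_le_two hA hb'
  refine ⟨C * (A * A'), 2 * R + 2, by positivity, fun α => ?_⟩
  set I := Finset.univ.sigma (fun j => Finset.range (α j)) with hI
  have h1 := hbd.prod_zCoord_mul I (fun i => i.1) hsm (by norm_num) hR
  have hcard : I.card = ∑ j, α j := by rw [hI, Finset.card_sigma]; simp
  rw [hcard] at h1
  set G : gevreySpace s (RSp d × RSp d) := laplaceFun hs (expIntegrable_hermiteWindow α) with hG
  have hκ := hermiteNorm_pos α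
  have e : (((hermiteNorm α : ℂ)⁻¹ • G : gevreySpace s (RSp d × RSp d)) : RSp d × RSp d → ℂ) =
      fun p => (∏ i ∈ I, zCoord i.1 p) * (positionGaussian p *
        ∫ t, Complex.exp (dualForm t p) * hermiteWindow 0 t) := by
    ext p
    have h0 := laplaceTransform_hermiteWindow (d := d) 0 p
    rw [laplaceTransform, hermiteNorm_zero] at h0
    simp only [Submodule.coe_smul, Pi.smul_apply, smul_eq_mul, hG, laplaceFun,
      laplaceTransform_hermiteWindow]
    rw [prod_sigma_range_zCoord, h0]
    have : (hermiteNorm α : ℂ) ≠ 0 := by exact_mod_cast hκ.ne'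
    field_simp
    simp
  have h2 := norm_apply_le_of_factorialBoundOn hs (by norm_num) hC _ e (by positivity) h1
  rw [map_smul, smul_eq_mul, norm_mul, norm_inv, Complex.norm_real, Real.norm_of_nonneg hκ.le,
    inv_mul_le_iff₀ hκ] at h2
  refine h2.trans_eq ?_
  ring

end HermiteFunctions


/-! ### Completeness of the Hermite functions in L² -/

section Completeness

variable {d : ℕ}

-- A test function is the Fourier transform of a Schwartz function H, and moving the transform from
-- H to ψ shows that ψ annihilates every test function.
open scoped FourierTransform in
theorem ae_eq_zero_of_fourier_eq_zero {ψ : RSp d → ℂ} (hψ : Integrable ψ)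
    (h : ∀ ξ, 𝓕 ψ ξ = 0) : ψ =ᵐ[volume] 0 := by
  refine ae_eq_zero_of_integral_contDiff_smul_eq_zero hψ.locallyIntegrable fun g hg hg' => ?_
  have hg₁ : HasCompactSupport (Complex.ofRealCLM ∘ g) := hg'.comp_left rfl
  have hg₂ : ContDiff ℝ ∞ (Complex.ofRealCLM ∘ g) := by fun_prop
  set G := hg₁.toSchwartzMap hg₂
  set H : SchwartzMap (RSp d) ℂ := 𝓕⁻ G with hH
  have e : ∀ x, 𝓕 (⇑H) x = (g x : ℂ) := fun x => by
    rw [← SchwartzMap.fourier_coe, hH, FourierTransform.fourier_fourierInv_eq]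
    rfl
  have key := VectorFourier.integral_fourierIntegral_smul_eq_flip (L := innerₗ (RSp d))
      (μ := volume) (ν := volume) (f := H) (g := ψ)
      Real.continuous_fourierChar continuous_inner (SchwartzMap.integrable _) hψ
  calc ∫ x, g x • ψ x = ∫ x, 𝓕 (⇑H) x • ψ x := by
        simp only [e, Complex.real_smul, smul_eq_mul]
    _ = ∫ x, H x • 𝓕 ψ x := by
        rw [flip_innerₗ] at key
        exact key
    _ = 0 := by simp [h]

open scoped FourierTransform in
theorem ae_eq_zero_of_laplaceTransform_eq_zero {ψ : RSp d → ℂ} (hψ : ExpIntegrable ψ)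
    (h : ∀ p, laplaceTransform ψ p = 0) : ψ =ᵐ[volume] 0 := by
  refine ae_eq_zero_of_fourier_eq_zero hψ.integrable_self fun ξ => ?_
  -- At x = 0 the Gaussian factor is 1 and t·z is purely imaginary; the factor -2π matches the
  -- normalisation of `𝓕`.
  have h1 := h (0, (-(2 * Real.pi)) • ξ)
  rw [laplaceTransform, positionGaussian] at h1
  simp only [norm_zero, ne_eq, OfNat.ofNat_ne_zero, not_false_eq_true, zero_pow, neg_zero, zero_div,
    Real.exp_zero, Complex.ofReal_one, one_mul] at h1
  rw [Real.fourier_eq', ← h1]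
  congr 1
  ext t
  rw [dualForm_eq_inner, smul_eq_mul]
  congr 2
  simp only [inner_zero_right, inner_smul_right]
  push_cast
  ring

/-- With all moments zero, the transform equals its Taylor remainder of every order N, which is
O(2^{-N}) at a fixed point. -/
theorem laplaceTransform_eq_zero_of_moments {ψ : RSp d → ℂ} (hψ : ExpIntegrable ψ)
    (h : ∀ (n : ℕ) (k : Fin n → Fin d), ∫ t, (∏ i, (t (k i) : ℂ)) * ψ t = 0) (p : RSp d × RSp d) :
    laplaceTransform ψ p = 0 := by
  have hb := fun N => (hψ.expTail_bounds dualForm N (K := {p}) (R := ‖p‖) (by simp)).2 0 p rfl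
  simp only [norm_iteratedFDeriv_zero, pow_zero, mul_one, Nat.factorial_zero, Nat.cast_one] at hb
  set I := ∫ t, Real.exp ((2 * ‖p‖ + 1) * ‖dualForm t‖) * ‖ψ t‖
  have hle : ∀ N : ℕ, ‖laplaceTransform ψ p‖ ≤ ‖positionGaussian p‖ * ((1 / 2) ^ N * I) := fun N => by
    rw [laplaceTransform_eq_sum_add hψ N p]
    simp only [h, zero_div, zero_mul, Finset.sum_const_zero, zero_add]
    rw [norm_mul]
    gcongr
    exact hb N
  have h0 : Filter.Tendsto (fun N : ℕ => ‖positionGaussian p‖ * ((1 / 2 : ℝ) ^ N * I)) Filter.atTop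
      (nhds 0) := by
    simpa using ((tendsto_pow_atTop_nhds_zero_of_lt_one (r := (1 / 2 : ℝ)) (by norm_num)
        (by norm_num)).mul_const I).const_mul ‖positionGaussian p‖
  exact norm_le_zero_iff.1 (ge_of_tendsto' h0 hle)

theorem ExpIntegrable.prod_eval_mul {ψ : RSp d → ℂ} (hψ : ExpIntegrable ψ)
    (q : Fin d → Polynomial ℝ) :
    ExpIntegrable (fun t => ((∏ j, (q j).eval (t j) : ℝ) : ℂ) * ψ t) := by
  choose C hC h using fun j => (q j).exists_abs_eval_le_exp
  have hcont : Continuous (fun t : RSp d => ((∏ j, (q j).eval (t j) : ℝ) : ℂ)) :=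
    Complex.continuous_ofReal.comp (continuous_finsetProd _ fun j _ => (q j).continuous.comp
      (EuclideanSpace.proj (𝕜 := ℝ) j).continuous)
  refine hψ.of_norm_le (hcont.aestronglyMeasurable.mul hψ.aestronglyMeasurable) (C := ∏ j, C j)
    (R := d) fun t => ?_
  rw [norm_mul, ← mul_assoc, Complex.norm_real, Real.norm_eq_abs, Finset.abs_prod]
  gcongr
  refine (Finset.prod_le_prod (fun _ _ => abs_nonneg _) fun j _ => h j (t j)).trans ?_
  rw [Finset.prod_mul_distrib, ← Real.exp_sum]
  gcongr
  · exact Finset.prod_nonneg fun j _ => hC j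
  · calc ∑ j, |t j| ≤ ∑ _j : Fin d, ‖t‖ :=
          Finset.sum_le_sum fun j _ => PiLp.norm_apply_le t j
      _ = _ := by simp

theorem prod_eval_update (q : Fin d → Polynomial ℝ) (i : Fin d) (z : Polynomial ℝ) (t : Fin d → ℝ)
    [DecidableEq (Fin d)] :
    ∏ j, (Function.update q i z j).eval (t j) =
      ∏ j, Function.update (fun j => (q j).eval (t j)) i (z.eval (t i)) j := by
  refine Finset.prod_congr rfl fun j _ => ?_
  rcases eq_or_ne j i with rfl | hj
  · simp
  · simp [hj]

/-- The integrals of `ψ` against products of polynomials, as a multilinear map. -/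
def momentMap {ψ : RSp d → ℂ} (hψ : ExpIntegrable ψ) :
    MultilinearMap ℝ (fun _ : Fin d => Polynomial ℝ) ℂ where
  toFun q := ∫ t, ((∏ j, (q j).eval (t j) : ℝ) : ℂ) * ψ t
  map_update_add' q i x y := by
    rw [← integral_add (hψ.prod_eval_mul _).integrable_self (hψ.prod_eval_mul _).integrable_self]
    congr 1
    ext t
    rw [← add_mul, ← Complex.ofReal_add]
    congr 2
    have := (MultilinearMap.mkPiAlgebra ℝ (Fin d) ℝ).map_update_add (fun j => (q j).eval (t j)) i
      (x.eval (t i)) (y.eval (t i))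
    simp only [MultilinearMap.mkPiAlgebra_apply] at this
    rw [prod_eval_update, prod_eval_update, prod_eval_update, Polynomial.eval_add]
    exact this
  map_update_smul' q i a x := by
    rw [Complex.real_smul, ← integral_const_mul]
    congr 1
    ext t
    rw [← mul_assoc, ← Complex.ofReal_mul]
    congr 2
    have := (MultilinearMap.mkPiAlgebra ℝ (Fin d) ℝ).map_update_smul (fun j => (q j).eval (t j)) i
      a (x.eval (t i))
    simp only [MultilinearMap.mkPiAlgebra_apply] at this
    rw [prod_eval_update, prod_eval_update, Polynomial.eval_smul]
    exact this

/-- The polynomials `p_n` as a polynomial sequence. -/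
def gaussPolySequence : Polynomial.Sequence ℝ := ⟨gaussPoly, degree_gaussPoly⟩

/-- Since p_n has degree exactly n, these polynomials form a basis of ℝ[X], and a multilinear map
vanishing on tuples of basis vectors is zero. This passes from Hermite coefficients to monomial
moments without inverting a triangular system. -/
theorem momentMap_eq_zero {ψ : RSp d → ℂ} (hψ : ExpIntegrable ψ)
    (h : ∀ α : Fin d → ℕ, ∫ t, ((∏ j, (gaussPoly (α j)).eval (t j) : ℝ) : ℂ) * ψ t = 0) :
    momentMap hψ = 0 := by
  have hu : ∀ i, IsUnit (gaussPolySequence i).leadingCoeff := fun i =>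
    (Polynomial.leadingCoeff_ne_zero.2 (gaussPolySequence.ne_zero i)).isUnit
  refine Module.Basis.ext_multilinear (fun _ => gaussPolySequence.basis hu) fun v => ?_
  simp only [Polynomial.Sequence.basis_eq_self]
  exact h v

theorem prod_word_eq {R : Type*} [CommMonoid R] {n : ℕ} (k : Fin n → Fin d) (x : Fin d → R) :
    ∏ i, x (k i) = ∏ j, x j ^ (Finset.univ.filter fun i => k i = j).card := by
  rw [← Finset.prod_fiberwise Finset.univ k]
  refine Finset.prod_congr rfl fun j _ => ?_
  rw [Finset.prod_congr rfl (g := fun _ => x j) fun i hi => by rw [(Finset.mem_filter.1 hi).2],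
    Finset.prod_const]

theorem expIntegrable_gaussianWindow : ExpIntegrable (gaussianWindow d) := by
  have hw := expIntegrable_mul_gaussianWindow (d := d) (g := fun _ => 1)
    aestronglyMeasurable_const (C := 1) (by simp)
  simpa only [one_mul] using hw

/-- In the square, one of the two windows is bounded by π^{-d/4}; the other is integrable against
e^{2R|t|}. -/
theorem memLp_exp_mul_gaussianWindow (R : ℝ) :
    MemLp (fun t : RSp d => Real.exp (R * ‖t‖) * ‖gaussianWindow d t‖) 2 volume := by
  have hw := expIntegrable_gaussianWindow (d := d)
  have hm : AEStronglyMeasurable (fun t : RSp d => Real.exp (R * ‖t‖) * ‖gaussianWindow d t‖)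
      volume := (Real.continuous_exp.comp
        (continuous_const.mul continuous_norm)).aestronglyMeasurable.mul hw.1.norm
  refine (memLp_two_iff_integrable_sq hm).2 ?_
  refine ((hw.integrable (2 * R)).const_mul (Real.pi ^ (-(d : ℝ) / 4))).mono' (hm.pow 2)
    (Filter.Eventually.of_forall fun t => ?_)
  have hle : ‖gaussianWindow d t‖ ≤ Real.pi ^ (-(d : ℝ) / 4) := by
    rw [gaussianWindow, Complex.norm_real, Real.norm_of_nonneg (by positivity)]
    refine mul_le_of_le_one_right (by positivity) (Real.exp_le_one_iff.2 ?_)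
    have := sq_nonneg ‖t‖
    linarith
  rw [Real.norm_of_nonneg (by positivity), mul_pow, sq ‖gaussianWindow d t‖, ← Real.exp_nat_mul]
  push_cast
  rw [mul_assoc 2 R]
  calc _ ≤ Real.exp (2 * (R * ‖t‖)) * (Real.pi ^ (-(d : ℝ) / 4) * ‖gaussianWindow d t‖) := by
        gcongr
    _ = _ := by ring

theorem expIntegrable_mul_gaussianWindow_of_memLp {f : RSp d → ℂ} (hf : MemLp f 2 volume) :
    ExpIntegrable (fun t => f t * gaussianWindow d t) := by
  refine ⟨hf.1.mul expIntegrable_gaussianWindow.1, fun R => ?_⟩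
  refine (hf.norm.integrable_mul (memLp_exp_mul_gaussianWindow R)).congr
    (Filter.Eventually.of_forall fun t => ?_)
  simp only [Pi.mul_apply, norm_mul]
  ring

theorem ofReal_hermiteFun_eq (α : Fin d → ℕ) :
    ∃ κ : ℂ, κ ≠ 0 ∧ ∀ t : RSp d, (hermiteFun α t : ℂ) =
      κ * (((∏ j, (gaussPoly (α j)).eval (t j) : ℝ) : ℂ) * gaussianWindow d t) := by
  refine ⟨(((-1) ^ (∑ j, α j) * hermiteNorm α : ℝ) : ℂ), ?_, fun t => ?_⟩
  · have := hermiteNorm_pos α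
    exact Complex.ofReal_ne_zero.2 (mul_ne_zero (pow_ne_zero _ (by norm_num)) this.ne')
  · rw [gaussianWindow, ← Complex.ofReal_mul, ← Complex.ofReal_mul]
    congr 1
    change Real.pi ^ (-(d : ℝ) / 4) * (-1) ^ (∑ j, α j) * hermiteNorm α * Real.exp (‖t‖ ^ 2 / 2) *
      (∏ j, gaussDeriv (α j) (t j)) = _
    have he : Real.exp (‖t‖ ^ 2 / 2) * Real.exp (-‖t‖ ^ 2) = Real.exp (-‖t‖ ^ 2 / 2) := by
      rw [← Real.exp_add]
      congr 1
      ring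
    have hp : ∏ j, gaussDeriv (α j) (t j) = (∏ j, (gaussPoly (α j)).eval (t j)) *
        Real.exp (-‖t‖ ^ 2) := by
      simp only [gaussDeriv_eq, Finset.prod_mul_distrib, ← Real.exp_sum, EuclideanSpace.norm_sq_eq,
        Real.norm_eq_abs, sq_abs, Finset.sum_neg_distrib]
    rw [hp, ← he]
    ring

/-- The Hermite functions are complete in `L²`. -/
theorem ae_eq_zero_of_hermiteCoeff_eq_zero {f : RSp d → ℂ} (hf : MemLp f 2 volume)
    (h : ∀ α, hermiteCoeff f α = 0) : f =ᵐ[volume] 0 := by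
  have hψ := expIntegrable_mul_gaussianWindow_of_memLp hf
  have hM : momentMap hψ = 0 := momentMap_eq_zero hψ fun α => by
    obtain ⟨κ, hκ, e⟩ := ofReal_hermiteFun_eq α
    have h1 := h α
    rw [hermiteCoeff] at h1
    simp only [e] at h1
    have h2 : κ * ∫ t, ((∏ j, (gaussPoly (α j)).eval (t j) : ℝ) : ℂ) * (f t * gaussianWindow d t) =
        0 := by
      rw [← integral_const_mul, ← h1]
      congr 1
      ext t
      ring
    exact (mul_eq_zero.1 h2).resolve_left hκ
  have hL := laplaceTransform_eq_zero_of_moments hψ fun n k => by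
    have := congrArg (fun M => M fun j => Polynomial.X ^
      (Finset.univ.filter fun i => k i = j).card) hM
    simp only [_root_.zero_apply] at this
    rw [← this]
    change _ = ∫ t, _
    congr 1
    ext t
    rw [prod_word_eq k (fun j => (t j : ℂ))]
    simp
  filter_upwards [ae_eq_zero_of_laplaceTransform_eq_zero hψ hL] with t ht
  refine (mul_eq_zero.1 ht).resolve_right ?_
  rw [gaussianWindow]
  exact_mod_cast (mul_pos (Real.rpow_pos_of_pos Real.pi_pos _) (Real.exp_pos _)).ne'

end Completeness


/-! ### The adjoint as an L² function and its Hermite coefficients -/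

section Adjoint

variable {d : ℕ} {s : ℝ}

/-- The function is the density P times φ, and the exponential growth of P is beaten by the
Gaussian. The identity is stated for all g with gφ exponentially integrable, so that it covers
Gelfand–Shilov functions and Hermite functions alike. -/
theorem exists_memLp_of_mem_gevreyDual (hs : 1 ≤ s)
    {F : Module.Dual ℂ (gevreySpace s (RSp d × RSp d))} (hF : F ∈ gevreyDual s (RSp d × RSp d)) :
    ∃ f₁ : RSp d → ℂ, MemLp f₁ 2 volume ∧
      ∀ (g : RSp d → ℂ) (hg : ExpIntegrable (fun t => g t * gaussianWindow d t)),
        F (laplaceFun hs hg) = ∫ t, f₁ t * g t := by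
  obtain ⟨P, C, S, hP, hle, h⟩ := exists_density_of_mem_gevreyDual hs hF
  refine ⟨fun t => P t * gaussianWindow d t, ?_, fun g hg => ?_⟩
  · refine ((memLp_exp_mul_gaussianWindow S).const_mul C).mono
      (hP.mul expIntegrable_gaussianWindow.1) (Filter.Eventually.of_forall fun t => ?_)
    refine le_trans ?_ (le_abs_self _)
    rw [norm_mul, ← mul_assoc]
    gcongr
    exact hle t
  · rw [h _ hg]
    congr 1
    ext t
    ring

theorem gelfandShilov_bounded (g : gelfandShilov s (RSp d)) :
    ∃ C : ℝ, ∀ t, ‖(g : RSp d → ℂ) t‖ ≤ C := by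
  obtain ⟨h, M, _, _, hb⟩ := g.2.2
  exact ⟨M, fun t => by simpa using hb 0 0 t⟩

theorem expIntegrable_gelfandShilov_mul (g : gelfandShilov s (RSp d)) :
    ExpIntegrable (fun t => (g : RSp d → ℂ) t * gaussianWindow d t) := by
  obtain ⟨C, hC⟩ := gelfandShilov_bounded g
  exact expIntegrable_mul_gaussianWindow g.2.1.continuous.aestronglyMeasurable hC

theorem gelfandShilovConj_conj (g : gelfandShilov s (RSp d)) :
    gelfandShilovConj (gelfandShilovConj g) = g := by
  ext x
  simp [gelfandShilovConj]

theorem conj_stft_gelfandShilov (g : gelfandShilov (1 / 2) (RSp d)) (p : RSp d × RSp d) :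
    conj (stft (gaussianWindow d) (g : RSp d → ℂ) p) = laplaceTransform
      (fun t => (gelfandShilovConj g : RSp d → ℂ) t * gaussianWindow d t) p :=
  conj_stft_gaussianWindow _ _

theorem IsStftAdjoint.eq_integral (hs : 1 ≤ s)
    {F : Module.Dual ℂ (gevreySpace s (RSp d × RSp d))}
    {f : Module.Dual ℂ (gelfandShilov (1 / 2) (RSp d))}
    (h : IsStftAdjoint (gaussianWindow d) F f) {f₁ : RSp d → ℂ}
    (h₁ : ∀ (g : RSp d → ℂ) (hg : ExpIntegrable (fun t => g t * gaussianWindow d t)),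
        F (laplaceFun hs hg) = ∫ t, f₁ t * g t) (g : gelfandShilov (1 / 2) (RSp d)) :
    f g = ∫ t, f₁ t * (g : RSp d → ℂ) t := by
  obtain ⟨G, hG, hf⟩ := h (gelfandShilovConj g)
  rw [gelfandShilovConj_conj] at hf
  rw [hf, ← h₁ _ (expIntegrable_gelfandShilov_mul g)]
  congr 1
  ext p
  rw [hG, conj_stft_gelfandShilov, gelfandShilovConj_conj]
  rfl

theorem hermiteNorm_eq (α : Fin d → ℕ) : hermiteNorm α =
    (2 ^ (-(1 / 2) : ℝ)) ^ (∑ j, α j) * (∏ j, ((α j)! : ℝ)) ^ (-(1 / 2) : ℝ) := by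
  rw [hermiteNorm, Real.mul_rpow (by positivity) (Finset.prod_nonneg fun _ _ => by positivity),
    ← Real.rpow_natCast (2 ^ (-(1 / 2) : ℝ)), ← Real.rpow_natCast (2 : ℝ),
    ← Real.rpow_mul zero_le_two, ← Real.rpow_mul zero_le_two, mul_comm (-(1 / 2) : ℝ)]

theorem memPilipovicFlat_of_isStftAdjoint (hs : 1 ≤ s)
    {F : Module.Dual ℂ (gevreySpace s (RSp d × RSp d))} (hF : F ∈ gevreyDual s (RSp d × RSp d))
    {f : Module.Dual ℂ (gelfandShilov (1 / 2) (RSp d))}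
    (h : IsStftAdjoint (gaussianWindow d) F f) : MemPilipovicFlat 1 f := by
  obtain ⟨f₁, hf₁, h₁⟩ := exists_memLp_of_mem_gevreyDual hs hF
  refine ⟨f₁, ⟨hf₁, ?_⟩, h.eq_integral hs h₁⟩
  obtain ⟨C, R, hR, hC⟩ := exists_norm_apply_hermite_le hs hF
  refine ⟨fun _ => R * 2 ^ (-(1 / 2) : ℝ), fun _ => by positivity, C, fun α => ?_⟩
  have e := h₁ (fun t => (hermiteFun α t : ℂ)) (expIntegrable_hermiteWindow α)
  rw [hermiteCoeff, ← e]
  refine (hC α).trans_eq ?_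
  rw [Finset.prod_pow_eq_pow_sum, mul_pow, hermiteNorm_eq, mul_one, mul_assoc]

theorem integrable_mul_of_isBoundedCompactlySupported {F : RSp d × RSp d → ℂ}
    (hF : IsBoundedCompactlySupported F) {G : RSp d × RSp d → ℂ} (hG : Continuous G) :
    Integrable (fun p => F p * G p) := by
  have hsub : Function.support (fun p => F p * G p) ⊆ tsupport F := fun p hp =>
    subset_tsupport F (left_ne_zero_of_mul hp)
  rw [← integrableOn_iff_integrable_of_support_subset hsub]
  have hi : IntegrableOn G (tsupport F) := hG.continuousOn.integrableOn_compact hF.2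
  exact hi.mul_of_top_right (hF.1.restrict _)

/-- The Gevrey distribution given by a bounded function of compact support. -/
def functionDual (s : ℝ) {F : RSp d × RSp d → ℂ} (hF : IsBoundedCompactlySupported F) :
    Module.Dual ℂ (gevreySpace s (RSp d × RSp d)) where
  toFun G := ∫ p, F p * (G : RSp d × RSp d → ℂ) p
  map_add' G H := by
    rw [← integral_add (integrable_mul_of_isBoundedCompactlySupported hF G.2.1.continuous)
      (integrable_mul_of_isBoundedCompactlySupported hF H.2.1.continuous)]
    simp [mul_add]
  map_smul' c G := by
    rw [RingHom.id_apply, smul_eq_mul, ← integral_const_mul]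
    simp [mul_left_comm]

theorem functionDual_mem (s : ℝ) {F : RSp d × RSp d → ℂ} (hF : IsBoundedCompactlySupported F) :
    functionDual s hF ∈ gevreyDual s (RSp d × RSp d) := by
  refine ⟨tsupport F, hF.2, fun h _ => ⟨∫ p, ‖F p‖, fun G M hM hb => ?_⟩⟩
  have hi : Integrable F := by
    simpa using integrable_mul_of_isBoundedCompactlySupported hF (G := fun _ => 1) continuous_const
  rw [← integral_mul_const]
  refine norm_integral_le_of_norm_le (hi.norm.mul_const M) (Filter.Eventually.of_forall fun p => ?_)
  rw [norm_mul]
  by_cases hp : p ∈ tsupport F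
  · gcongr
    simpa using hb 0 p hp
  · simp [image_eq_zero_of_notMem_tsupport hp]

theorem IsStftAdjointFun.isStftAdjoint (hs : 1 ≤ s) {F : RSp d × RSp d → ℂ}
    (hF : IsBoundedCompactlySupported F) {f : Module.Dual ℂ (gelfandShilov (1 / 2) (RSp d))}
    (h : IsStftAdjointFun (gaussianWindow d) F f) :
    IsStftAdjoint (gaussianWindow d) (functionDual s hF) f := fun g => by
  refine ⟨laplaceFun hs (expIntegrable_gelfandShilov_mul (gelfandShilovConj g)),
    fun p => (conj_stft_gelfandShilov g p).symm, ?_⟩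
  rw [h g]
  change _ = ∫ p, F p * laplaceTransform _ p
  congr 1
  ext p
  rw [conj_stft_gelfandShilov]

/-- If the values of `F` on the transforms of the Hermite functions are the Hermite coefficients
of `f₀`, then `f₀ = V_φ^* F`. -/
theorem isStftAdjointFun_of_hermiteCoeff {F : RSp d × RSp d → ℂ}
    (hF : IsBoundedCompactlySupported F) {f : Module.Dual ℂ (gelfandShilov (1 / 2) (RSp d))}
    {f₀ : RSp d → ℂ} (hf₀ : MemLp f₀ 2 volume)
    (hf : ∀ g : gelfandShilov (1 / 2) (RSp d), f g = ∫ x, f₀ x * (g : RSp d → ℂ) x)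
    (h : ∀ α, ∫ p, F p * laplaceTransform (hermiteWindow α) p = hermiteCoeff f₀ α) :
    IsStftAdjointFun (gaussianWindow d) F f := fun g => by
  -- Viewed as a Gevrey distribution of order 1, F has an L² function f₁ as adjoint. It remains to
  -- identify f₁ with f₀, which completeness reduces to equality of Hermite coefficients.
  obtain ⟨f₁, hf₁, h₁⟩ := exists_memLp_of_mem_gevreyDual le_rfl (functionDual_mem 1 hF)
  have hmul : ∀ {u : RSp d → ℂ}, MemLp u 2 volume → ∀ α,
      Integrable (fun t => u t * (hermiteFun α t : ℂ)) := fun {u} hu α => by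
    obtain ⟨κ, hκ, e⟩ := ofReal_hermiteFun_eq α
    have := (((expIntegrable_mul_gaussianWindow_of_memLp hu).prod_eval_mul
      (fun j => gaussPoly (α j))).const_mul κ).integrable_self
    refine this.congr (Filter.Eventually.of_forall fun t => ?_)
    simp only [e]
    ring
  have h0 : f₀ - f₁ =ᵐ[volume] 0 := by
    refine ae_eq_zero_of_hermiteCoeff_eq_zero (hf₀.sub hf₁) fun α => ?_
    have e := h₁ (fun t => (hermiteFun α t : ℂ)) (expIntegrable_hermiteWindow α)
    have e' : ∫ t, f₁ t * (hermiteFun α t : ℂ) = hermiteCoeff f₀ α := by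
      rw [← h α, ← e]
      rfl
    rw [hermiteCoeff]
    simp only [Pi.sub_apply, sub_mul]
    rw [integral_sub (hmul hf₀ α) (hmul hf₁ α), e', hermiteCoeff, sub_self]
  have e := h₁ _ (expIntegrable_gelfandShilov_mul (gelfandShilovConj g))
  calc _ = ∫ t, f₁ t * (gelfandShilovConj g : RSp d → ℂ) t := by
        rw [hf]
        refine integral_congr_ae ?_
        filter_upwards [h0] with t ht
        rw [sub_eq_zero.1 ht]
    _ = ∫ p, F p * laplaceTransform _ p := e.symm
    _ = _ := by
        congr 1
        ext p
        rw [conj_stft_gelfandShilov]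

end Adjoint


/-! ### Inverting the exponential of the shift operator -/

section Shift

/-- The vector is y = exp(-cT) x, because exp(cT) exp(-cT) = 1 for a bounded operator T. -/
theorem exists_hasSum_pow_apply {X : Type*} [NormedAddCommGroup X] [NormedSpace ℂ X]
    [CompleteSpace X] (T : X →L[ℂ] X) (c : ℂ) (x : X) :
    ∃ y, HasSum (fun n : ℕ => (c ^ n / (n ! : ℂ)) • (T ^ n) y) x := by
  let _ : NormedAlgebra ℚ (X →L[ℂ] X) := NormedAlgebra.restrictScalars ℚ ℂ _
  refine ⟨NormedSpace.exp ((-c) • T) x, ?_⟩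
  have hc : Commute (c • T) ((-c) • T) := ((Commute.refl T).smul_left c).smul_right (-c)
  have h := NormedSpace.exp_add_of_commute hc
  rw [← add_smul, add_neg_cancel, zero_smul, NormedSpace.exp_zero] at h
  have h1 : NormedSpace.exp (c • T) (NormedSpace.exp ((-c) • T) x) = x :=
    (congrArg (fun S => S x) h).symm
  have h2 := (NormedSpace.exp_series_hasSum_exp' (𝕂 := ℂ) (c • T)).mapL
    (ContinuousLinearMap.apply ℂ X (NormedSpace.exp ((-c) • T) x))
  rw [ContinuousLinearMap.apply_apply, h1] at h2
  refine h2.congr_fun fun n => ?_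
  rw [ContinuousLinearMap.apply_apply, smul_pow, smul_smul, _root_.smul_apply,
    div_eq_inv_mul]

variable {d : ℕ}

/-- The operator `(a_α) ↦ (∑_j a_{α + 2 e_j})`. -/
def shiftSum (a : (Fin d → ℕ) → ℂ) (α : Fin d → ℕ) : ℂ := ∑ j, a (α + Pi.single j 2)

open BoundedContinuousFunction in
/-- The operator `shiftSum` on sequences weighted by `R^{|α|}`. -/
def weightedShift (R : ℝ) : ((Fin d → ℕ) →ᵇ ℂ) →L[ℂ] ((Fin d → ℕ) →ᵇ ℂ) :=
  LinearMap.mkContinuous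
    { toFun := fun x => BoundedContinuousFunction.ofNormedAddCommGroupDiscrete
        (fun α => (R : ℂ) ^ 2 * ∑ j, x (α + Pi.single j 2)) (|R| ^ 2 * (d * ‖x‖)) fun α => by
          rw [norm_mul, norm_pow, Complex.norm_real, Real.norm_eq_abs]
          gcongr
          refine (norm_sum_le_of_le _ fun j _ => x.norm_coe_le_norm _).trans_eq ?_
          simp
      map_add' := fun x y => by
        ext α
        simp [Finset.sum_add_distrib, mul_add]
      map_smul' := fun c x => by
        ext α
        simp [← Finset.mul_sum, mul_left_comm] }
    (|R| ^ 2 * d) fun x => by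
      refine (BoundedContinuousFunction.norm_le (by positivity)).2 fun α => ?_
      change ‖(R : ℂ) ^ 2 * ∑ j, x (α + Pi.single j 2)‖ ≤ _
      rw [norm_mul, norm_pow, Complex.norm_real, Real.norm_eq_abs, mul_assoc]
      gcongr
      refine (norm_sum_le_of_le _ fun j _ => x.norm_coe_le_norm _).trans_eq ?_
      simp

open BoundedContinuousFunction in
theorem weightedShift_apply (R : ℝ) (x : (Fin d → ℕ) →ᵇ ℂ) (α : Fin d → ℕ) :
    weightedShift R x α = (R : ℂ) ^ 2 * ∑ j, x (α + Pi.single j 2) := rfl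

open BoundedContinuousFunction in
theorem weightedShift_pow_apply (R : ℝ) (n : ℕ) (x : (Fin d → ℕ) →ᵇ ℂ) (α : Fin d → ℕ) :
    (R : ℂ) ^ (∑ j, α j) * ((weightedShift R ^ n) x) α =
      (shiftSum^[n] fun α => (R : ℂ) ^ (∑ j, α j) * x α) α := by
  induction n generalizing α with
  | zero => simp
  | succ n ih =>
    rw [pow_succ']
    change _ * weightedShift R ((weightedShift R ^ n) x) α = _
    rw [weightedShift_apply, Function.iterate_succ_apply',
      shiftSum, Finset.mul_sum, Finset.mul_sum]
    refine Finset.sum_congr rfl fun j _ => ?_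
    rw [← ih, ← mul_assoc, ← pow_add]
    congr 2
    simp [Finset.sum_add_distrib]

open BoundedContinuousFunction in
/-- The exponential of `shiftSum` is invertible on sequences of geometric growth. -/
theorem exists_hasSum_shiftSum {a : (Fin d → ℕ) → ℂ} {C R : ℝ} (hR : 0 < R)
    (ha : ∀ α, ‖a α‖ ≤ C * R ^ (∑ j, α j)) (c : ℂ) :
    ∃ (b : (Fin d → ℕ) → ℂ) (C' : ℝ), 0 ≤ C' ∧ (∀ α, ‖b α‖ ≤ C' * R ^ (∑ j, α j)) ∧
      ∀ α, HasSum (fun n : ℕ => c ^ n / (n ! : ℂ) * (shiftSum^[n] b) α) (a α) := by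
  have hRC : (R : ℂ) ≠ 0 := by exact_mod_cast hR.ne'
  -- Division by R^{|α|} makes the sequence bounded and conjugates the shift by 2e_j into R² times
  -- the unweighted shift, a bounded operator.
  set x : (Fin d → ℕ) →ᵇ ℂ := BoundedContinuousFunction.ofNormedAddCommGroupDiscrete
    (fun α => a α / (R : ℂ) ^ (∑ j, α j)) C (fun α => by
      rw [norm_div, norm_pow, Complex.norm_real, Real.norm_of_nonneg hR.le, div_le_iff₀
        (by positivity)]
      exact ha α) with hx
  have hxa : ∀ α, (R : ℂ) ^ (∑ j, α j) * x α = a α := fun α =>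
    mul_div_cancel₀ _ (pow_ne_zero _ hRC)
  obtain ⟨y, hy⟩ := exists_hasSum_pow_apply (weightedShift R) c x
  refine ⟨fun α => (R : ℂ) ^ (∑ j, α j) * y α, ‖y‖, norm_nonneg _, fun α => ?_, fun α => ?_⟩
  · rw [norm_mul, norm_pow, Complex.norm_real, Real.norm_of_nonneg hR.le, mul_comm]
    gcongr
    exact y.norm_coe_le_norm α
  · have h := (hy.mapL (BoundedContinuousFunction.evalCLM ℂ α)).mul_left ((R : ℂ) ^ (∑ j, α j))
    rw [BoundedContinuousFunction.evalCLM_apply, hxa] at h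
    refine h.congr_fun fun n => ?_
    rw [← weightedShift_pow_apply]
    simp only [map_smul, smul_eq_mul, BoundedContinuousFunction.evalCLM_apply]
    ring

end Shift

/-! ### Orthogonality of monomials on discs and polydiscs -/

section DiscMoments

/-- The Gaussian moments of the disc of radius `ρ`. -/
def discMoment (ρ : ℝ) (n : ℕ) : ℝ :=
  ∫ w in Metric.closedBall (0 : ℂ) ρ, ‖w‖ ^ (2 * n) * Real.exp (-‖w‖ ^ 2 / 4)

theorem setIntegral_disc_monomials (ρ : ℝ) (m n : ℕ) :
    ∫ w in Metric.closedBall (0 : ℂ) ρ,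
      conj w ^ m * w ^ n * ((Real.exp (-‖w‖ ^ 2 / 4) : ℝ) : ℂ) =
      if m = n then (discMoment ρ n : ℂ) else 0 := by
  split_ifs with h
  · subst h
    rw [discMoment, ← integral_complex_ofReal]
    congr 1
    ext w
    rw [← mul_pow, Complex.conj_mul', pow_mul]
    push_cast
    ring
  · set f : ℂ → ℂ := (Metric.closedBall (0 : ℂ) ρ).indicator fun w =>
      conj w ^ m * w ^ n * ((Real.exp (-‖w‖ ^ 2 / 4) : ℝ) : ℂ) with hf
    rw [← integral_indicator Metric.isClosed_closedBall.measurableSet]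
    change ∫ w, f w = 0
    have hnm : (n : ℂ) - m ≠ 0 := sub_ne_zero.2 (by exact_mod_cast Ne.symm h)
    -- Rotation by θ multiplies w̄^m w^n by e^{i(n-m)θ} = -1 and preserves the disc, the weight and
    -- the measure, so the integral equals its negative.
    set θ : ℝ := Real.pi / ((n : ℝ) - m) with hθ
    set c : Circle := Circle.exp θ with hc
    have hrot : ∀ w, f (rotation c w) = -f w := fun w => by
      have hmem : rotation c w ∈ Metric.closedBall (0 : ℂ) ρ ↔ w ∈ Metric.closedBall (0 : ℂ) ρ := by
        rw [mem_closedBall_zero_iff, mem_closedBall_zero_iff, LinearIsometryEquiv.norm_map]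
      by_cases hw : w ∈ Metric.closedBall (0 : ℂ) ρ
      · rw [hf, Set.indicator_of_mem hw, Set.indicator_of_mem (hmem.2 hw),
          LinearIsometryEquiv.norm_map, rotation_apply, map_mul, mul_pow, mul_pow]
        have hcc : conj (c : ℂ) ^ m * (c : ℂ) ^ n = -1 := by
          rw [hc, Circle.coe_exp, ← Complex.exp_conj, ← Complex.exp_nat_mul, ← Complex.exp_nat_mul,
            ← Complex.exp_add, ← Complex.exp_pi_mul_I]
          congr 1
          rw [map_mul, Complex.conj_I, Complex.conj_ofReal, hθ]
          push_cast
          field_simp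
          ring
        linear_combination (conj w ^ m * w ^ n * ((Real.exp (-‖w‖ ^ 2 / 4) : ℝ) : ℂ)) * hcc
      · rw [hf, Set.indicator_of_notMem hw, Set.indicator_of_notMem (fun h => hw (hmem.1 h)),
          neg_zero]
    have h1 := (rotation c).measurePreserving.integral_comp
      (rotation c).toHomeomorph.measurableEmbedding f
    simp only [hrot] at h1
    rw [integral_neg] at h1
    exact self_eq_neg.1 h1.symm

theorem exists_discMoment_ge {ρ : ℝ} (hρ : 0 < ρ) :
    ∃ δ : ℝ, 0 < δ ∧ ∀ n, δ * (ρ / 2) ^ (2 * n) ≤ discMoment ρ n := by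
  -- This ball lies in the annulus ρ/2 ≤ |w| ≤ ρ, where the integrand is at least (ρ/2)^{2n}
  -- e^{-ρ²/4}.
  set B := Metric.ball ((3 * ρ / 4 : ℝ) : ℂ) (ρ / 4) with hB
  have hn : ‖((3 * ρ / 4 : ℝ) : ℂ)‖ = 3 * ρ / 4 := by
    rw [Complex.norm_real, Real.norm_of_nonneg (by positivity)]
  have hball : ∀ w ∈ B, ρ / 2 ≤ ‖w‖ ∧ ‖w‖ ≤ ρ := fun w hw => by
    rw [hB, Metric.mem_ball, dist_eq_norm] at hw
    have h1 := norm_sub_norm_le w ((3 * ρ / 4 : ℝ) : ℂ)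
    have h2 := norm_sub_norm_le ((3 * ρ / 4 : ℝ) : ℂ) w
    rw [norm_sub_rev] at h2
    rw [hn] at h1 h2
    constructor <;> linarith
  have hsub : B ⊆ Metric.closedBall 0 ρ := fun w hw => by
    rw [mem_closedBall_zero_iff]
    exact (hball w hw).2
  have hfin : volume B ≠ ⊤ := measure_ball_lt_top.ne
  have hpos : 0 < volume.real B := ENNReal.toReal_pos
    (Metric.measure_ball_pos volume _ (by positivity)).ne' hfin
  refine ⟨Real.exp (-ρ ^ 2 / 4) * volume.real B, by positivity, fun n => ?_⟩
  have hcont : Continuous (fun w : ℂ => ‖w‖ ^ (2 * n) * Real.exp (-‖w‖ ^ 2 / 4)) := by fun_prop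
  have hint := hcont.continuousOn.integrableOn_compact (μ := volume)
    (isCompact_closedBall (0 : ℂ) ρ)
  calc _ = ∫ _w in B, (ρ / 2) ^ (2 * n) * Real.exp (-ρ ^ 2 / 4) := by
        rw [setIntegral_const, smul_eq_mul]
        ring
    _ ≤ ∫ w in B, ‖w‖ ^ (2 * n) * Real.exp (-‖w‖ ^ 2 / 4) := by
        refine setIntegral_mono_on (integrableOn_const hfin) (hint.mono_set hsub)
          Metric.isOpen_ball.measurableSet fun w hw => ?_
        obtain ⟨h1, h2⟩ := hball w hw
        gcongr
    _ ≤ _ := setIntegral_mono_set hint (Filter.Eventually.of_forall fun w => by positivity)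
        hsub.eventuallyLE

variable {d : ℕ}

/-- The weight `e^{-|w|²/4}` on `ℂ^d`. -/
def polyWeight (w : Fin d → ℂ) : ℂ := ∏ j, ((Real.exp (-‖w j‖ ^ 2 / 4) : ℝ) : ℂ)

theorem continuous_polyWeight : Continuous (polyWeight (d := d)) := by
  unfold polyWeight
  fun_prop

theorem setIntegral_polydisc_monomials {ρ : ℝ} (hρ : 0 < ρ) (β α : Fin d → ℕ) :
    ∫ w in Metric.closedBall (0 : Fin d → ℂ) ρ,
      (∏ j, conj (w j) ^ β j) * (∏ j, w j ^ α j) * polyWeight w =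
      if β = α then ((∏ j, discMoment ρ (α j) : ℝ) : ℂ) else 0 := by
  have hpi : (Metric.closedBall (0 : Fin d → ℂ) ρ) =
      Set.univ.pi fun _ => Metric.closedBall (0 : ℂ) ρ := closedBall_pi _ hρ.le
  rw [hpi, volume_pi, Measure.restrict_pi_pi]
  simp only [polyWeight, ← Finset.prod_mul_distrib]
  rw [integral_fintype_prod_eq_prod (fun (j : Fin d) (w : ℂ) =>
    conj w ^ β j * w ^ α j * ((Real.exp (-‖w‖ ^ 2 / 4) : ℝ) : ℂ))]
  simp only [setIntegral_disc_monomials]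
  split_ifs with h
  · subst h
    simp
  · obtain ⟨j, hj⟩ := Function.ne_iff.1 h
    exact Finset.prod_eq_zero (Finset.mem_univ j) (if_neg hj)

end DiscMoments

/-! ### Power series with prescribed moments -/

section PowerSeries

variable {d : ℕ}

/-- The number of occurrences of each letter in a word. -/
def wordCount {n : ℕ} (k : Fin n → Fin d) (j : Fin d) : ℕ :=
  (Finset.univ.filter fun i => k i = j).card

theorem sum_wordCount {n : ℕ} (k : Fin n → Fin d) : ∑ j, wordCount k j = n := by
  have := Finset.card_eq_sum_card_fiberwise (s := Finset.univ) (t := Finset.univ) (f := k)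
    (fun _ _ => Finset.mem_coe.2 (Finset.mem_univ _))
  rw [Finset.card_univ, Fintype.card_fin] at this
  exact this.symm

theorem exists_wordCount_eq (β : Fin d → ℕ) : ∃ k : Fin (∑ j, β j) → Fin d, wordCount k = β := by
  refine ⟨fun i => (finSigmaFinEquiv (n := β).symm i).1, ?_⟩
  ext j
  have h : wordCount (fun i => (finSigmaFinEquiv (n := β).symm i).1) j =
      (Finset.univ.filter fun x : (j : Fin d) × Fin (β j) => x.1 = j).card := by
    refine Finset.card_equiv (finSigmaFinEquiv (n := β)).symm fun i => ?_
    simp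
  rw [h, ← Fintype.card_subtype]
  rw [Fintype.card_congr (Equiv.sigmaSubtype j)]
  simp

/-- The number of words with given numbers of occurrences of the letters. -/
def wordMult (β : Fin d → ℕ) : ℕ :=
  (Finset.univ.filter fun k : Fin (∑ j, β j) → Fin d => wordCount k = β).card

theorem wordMult_pos (β : Fin d → ℕ) : 0 < wordMult β := by
  obtain ⟨k, hk⟩ := exists_wordCount_eq β
  exact Finset.card_pos.2 ⟨k, by simp [hk]⟩

/-- The power series with coefficients `g_β`, written as a series of multilinear maps. -/
def multiSeries (g : (Fin d → ℕ) → ℂ) : FormalMultilinearSeries ℂ (Fin d → ℂ) ℂ := fun n =>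
  ∑ k : Fin n → Fin d, (g (wordCount k) / wordMult (wordCount k)) •
    (ContinuousMultilinearMap.mkPiAlgebra ℂ (Fin n) ℂ).compContinuousLinearMap
      fun i => ContinuousLinearMap.proj (k i)

theorem multiSeries_apply (g : (Fin d → ℕ) → ℂ) (n : ℕ) (w : Fin d → ℂ) :
    multiSeries g n (fun _ => w) = ∑ k : Fin n → Fin d,
      (g (wordCount k) / wordMult (wordCount k)) * ∏ j, w j ^ wordCount k j := by
  simp only [multiSeries, _root_.sum_apply, _root_.smul_apply,
    ContinuousMultilinearMap.compContinuousLinearMap_apply, ContinuousMultilinearMap.mkPiAlgebra_apply,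
    ContinuousLinearMap.proj_apply, smul_eq_mul]
  exact Finset.sum_congr rfl fun k _ => by rw [prod_word_eq k w]; rfl

/-- There are d^n words of length n, each contributing a product of coordinate projections of norm
at most 1 in the sup norm; division by the number of words with the same letter counts only
decreases the coefficients. -/
theorem norm_multiSeries_le {g : (Fin d → ℕ) → ℂ} {C q : ℝ}
    (hg : ∀ β, ‖g β‖ ≤ C * q ^ (∑ j, β j)) (n : ℕ) : ‖multiSeries g n‖ ≤ C * (d * q) ^ n := by
  refine (norm_sum_le_of_le (n := fun _ => C * q ^ n) _ fun k _ => ?_).trans_eq ?_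
  · rw [norm_smul]
    have h1 : ‖g (wordCount k) / wordMult (wordCount k)‖ ≤ C * q ^ n := by
      rw [norm_div, Complex.norm_natCast]
      have := hg (wordCount k)
      rw [sum_wordCount] at this
      refine (div_le_self (norm_nonneg _) ?_).trans this
      exact_mod_cast wordMult_pos _
    have h2 : ‖(ContinuousMultilinearMap.mkPiAlgebra ℂ (Fin n) ℂ).compContinuousLinearMap
        fun i => (ContinuousLinearMap.proj (k i) : (Fin d → ℂ) →L[ℂ] ℂ)‖ ≤ 1 := by
      refine ContinuousMultilinearMap.opNorm_le_bound zero_le_one fun m => ?_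
      simp only [ContinuousMultilinearMap.compContinuousLinearMap_apply,
        ContinuousMultilinearMap.mkPiAlgebra_apply, ContinuousLinearMap.proj_apply, one_mul, norm_prod]
      exact Finset.prod_le_prod (fun _ _ => norm_nonneg _) fun i _ => norm_le_pi_norm (m i) (k i)
    calc _ ≤ (C * q ^ n) * 1 := mul_le_mul h1 h2 (norm_nonneg _) ((norm_nonneg _).trans h1)
      _ = _ := mul_one _
  · simp
    ring

/-- Sequences of geometric growth are moment sequences of antiholomorphic functions on polydiscs. -/
theorem exists_analytic_moments {b : (Fin d → ℕ) → ℂ} {C R : ℝ} (hC : 0 ≤ C) (hR : 0 < R)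
    (hb : ∀ α, ‖b α‖ ≤ C * R ^ (∑ j, α j)) :
    ∃ (ρ : ℝ) (G : (Fin d → ℂ) → ℂ), 0 < ρ ∧ AnalyticOnNhd ℂ G (Metric.closedBall 0 ρ) ∧
      ∀ α, ∫ w in Metric.closedBall (0 : Fin d → ℂ) ρ,
        G (fun j => conj (w j)) * ((∏ j, w j ^ α j) * polyWeight w) = b α := by
  -- The moments grow like (ρ/2)^{2|α|}, so the coefficients g grow at rate q = 4R/ρ², and the
  -- homogeneous parts at rate dq. On radius 2ρ the ratio is 8dR/ρ, which this choice of ρ makes at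
  -- most 1/2. Convergence on twice the radius gives analyticity near the closed polydisc. The
  -- constant δ depends on ρ but does not affect the rate.
  set ρ : ℝ := 16 * R * (d + 1) with hρd
  have hρ : 0 < ρ := by positivity
  obtain ⟨δ, hδ, hmom⟩ := exists_discMoment_ge hρ
  have hN : ∀ α : Fin d → ℕ, δ ^ d * (ρ / 2) ^ (2 * ∑ j, α j) ≤ ∏ j, discMoment ρ (α j) := fun α => by
    refine le_trans (le_of_eq ?_) (Finset.prod_le_prod (fun j _ => by positivity) fun j _ => hmom (α j))
    rw [Finset.prod_mul_distrib, Finset.prod_pow_eq_pow_sum, Finset.mul_sum]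
    simp
  have hNpos : ∀ α : Fin d → ℕ, 0 < ∏ j, discMoment ρ (α j) := fun α =>
    lt_of_lt_of_le (by positivity) (hN α)
  set g : (Fin d → ℕ) → ℂ := fun α => b α / ((∏ j, discMoment ρ (α j) : ℝ) : ℂ) with hg
  set q : ℝ := R * (2 / ρ) ^ 2 with hq
  have hgb : ∀ α, ‖g α‖ ≤ C / δ ^ d * q ^ (∑ j, α j) := fun α => by
    rw [hg]
    simp only
    rw [norm_div, Complex.norm_real, Real.norm_of_nonneg (hNpos α).le, div_le_iff₀ (hNpos α)]
    refine (hb α).trans ?_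
    calc C * R ^ (∑ j, α j) = C / δ ^ d * q ^ (∑ j, α j) *
          (δ ^ d * (ρ / 2) ^ (2 * ∑ j, α j)) := by
          rw [hq, mul_pow, ← pow_mul, div_pow, div_pow]
          field_simp
      _ ≤ _ := by
          gcongr
          exact hN α
  have hqρ : d * q * (2 * ρ) ≤ 1 / 2 := by
    have e : d * q * (2 * ρ) = (d / (d + 1)) * (1 / 2) := by
      rw [hq, hρd]
      field_simp
      norm_num
    rw [e]
    refine mul_le_of_le_one_left (by norm_num) ?_
    rw [div_le_one (by positivity)]
    linarith
  have hq0 : 0 ≤ q := by positivity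
  have hC' : 0 ≤ C / δ ^ d := by positivity
  set P := multiSeries g with hP
  have hPn : ∀ n, ‖P n‖ ≤ C / δ ^ d * (d * q) ^ n := norm_multiSeries_le hgb
  have hPn2 : ∀ n, ‖P n‖ * (2 * ρ) ^ n ≤ C / δ ^ d * (1 / 2) ^ n := fun n => by
    calc _ ≤ C / δ ^ d * (d * q) ^ n * (2 * ρ) ^ n := by
          gcongr
          exact hPn n
      _ = C / δ ^ d * (d * q * (2 * ρ)) ^ n := by rw [mul_pow _ (2 * ρ), mul_assoc]
      _ ≤ _ := by gcongr
  have hrad : ((2 * ρ).toNNReal : ENNReal) ≤ P.radius := by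
    refine P.le_radius_of_bound (C / δ ^ d) fun n => ?_
    rw [Real.coe_toNNReal _ (by positivity)]
    refine (hPn2 n).trans (mul_le_of_le_one_right hC' ?_)
    exact pow_le_one₀ (by norm_num) (by norm_num)
  have hrad0 : 0 < P.radius := lt_of_lt_of_le (by simpa using hρ) hrad
  have hfps := P.hasFPowerSeriesOnBall hrad0
  have hball : Metric.closedBall (0 : Fin d → ℂ) ρ ⊆ Metric.eball 0 P.radius := fun w hw => by
    refine lt_of_lt_of_le ?_ hrad
    rw [edist_zero_right, ← ofReal_norm, ENNReal.ofReal]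
    rw [mem_closedBall_zero_iff] at hw
    exact_mod_cast (Real.toNNReal_lt_toNNReal_iff (by positivity)).2 (by linarith)
  refine ⟨ρ, P.sum, hρ, hfps.analyticOnNhd.mono hball, fun α => ?_⟩
  set u : (Fin d → ℂ) → ℂ := fun w => (∏ j, w j ^ α j) * polyWeight w with hu
  have hucont : Continuous u := (by fun_prop : Continuous fun w : Fin d → ℂ => ∏ j, w j ^ α j).mul
    continuous_polyWeight
  set F : ℕ → (Fin d → ℂ) → ℂ := fun n w => P n (fun _ => fun j => conj (w j)) * u w with hF
  have hFcont : ∀ n, Continuous (F n) := fun n =>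
    ((P n).cont.comp (continuous_pi fun _ => continuous_pi fun j =>
      Complex.continuous_conj.comp (continuous_apply j))).mul hucont
  have hK : IsCompact (Metric.closedBall (0 : Fin d → ℂ) ρ) := isCompact_closedBall _ _
  have hFint : ∀ n, IntegrableOn (F n) (Metric.closedBall 0 ρ) := fun n =>
    (hFcont n).continuousOn.integrableOn_compact hK
  obtain ⟨B, hB⟩ := hK.exists_bound_of_continuousOn hucont.continuousOn
  have hconj : ∀ w ∈ Metric.closedBall (0 : Fin d → ℂ) ρ,
      (fun j => conj (w j)) ∈ Metric.closedBall (0 : Fin d → ℂ) ρ := fun w hw => by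
    rw [mem_closedBall_zero_iff, pi_norm_le_iff_of_nonneg hρ.le] at hw ⊢
    simpa using hw
  have hFle : ∀ n, ∀ w ∈ Metric.closedBall (0 : Fin d → ℂ) ρ,
      ‖F n w‖ ≤ C / δ ^ d * (1 / 2) ^ n * B := fun n w hw => by
    rw [hF, norm_mul]
    gcongr
    · refine ((P n).le_opNorm _).trans (le_trans ?_ (hPn2 n))
      rw [Finset.prod_const, Finset.card_univ, Fintype.card_fin]
      gcongr
      have := mem_closedBall_zero_iff.1 (hconj w hw)
      linarith
    · exact hB w hw
  have hsum : Summable fun n => ∫ w in Metric.closedBall (0 : Fin d → ℂ) ρ, ‖F n w‖ := by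
    refine Summable.of_nonneg_of_le (fun n => integral_nonneg fun _ => norm_nonneg _) (fun n => ?_)
      (((summable_geometric_of_lt_one (r := (1 / 2 : ℝ)) (by norm_num)
        (by norm_num)).mul_left (C / δ ^ d)).mul_right
          (B * volume.real (Metric.closedBall (0 : Fin d → ℂ) ρ)))
    refine (setIntegral_mono_on (hFint n).norm (integrableOn_const hK.measure_lt_top.ne)
      Metric.isClosed_closedBall.measurableSet (hFle n)).trans_eq ?_
    rw [setIntegral_const, smul_eq_mul]
    ring
  have h1 := hasSum_integral_of_summable_integral_norm hFint hsum
  have h2 : ∫ w in Metric.closedBall (0 : Fin d → ℂ) ρ, P.sum (fun j => conj (w j)) * u w =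
      ∫ w in Metric.closedBall (0 : Fin d → ℂ) ρ, ∑' n, F n w := by
    refine setIntegral_congr_fun Metric.isClosed_closedBall.measurableSet fun w hw => ?_
    have := hfps.hasSum (hball (hconj w hw))
    rw [zero_add] at this
    exact (this.mul_right (u w)).tsum_eq.symm
  have h3 : ∀ n, ∫ w in Metric.closedBall (0 : Fin d → ℂ) ρ, F n w = ∑ k : Fin n → Fin d,
      if wordCount k = α then g α / wordMult α * ((∏ j, discMoment ρ (α j) : ℝ) : ℂ) else 0 := by
    intro n
    have hterm : ∀ k : Fin n → Fin d, IntegrableOn (fun w : Fin d → ℂ =>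
        (g (wordCount k) / wordMult (wordCount k)) *
          ((∏ j, conj (w j) ^ wordCount k j) * (∏ j, w j ^ α j) * polyWeight w))
        (Metric.closedBall 0 ρ) := fun k => by
      have hc : Continuous fun w : Fin d → ℂ => (g (wordCount k) / wordMult (wordCount k)) *
          ((∏ j, conj (w j) ^ wordCount k j) * (∏ j, w j ^ α j) * polyWeight w) := by
        have := continuous_polyWeight (d := d)
        have h' := Complex.continuous_conj
        fun_prop
      exact hc.continuousOn.integrableOn_compact hK
    calc _ = ∫ w in Metric.closedBall (0 : Fin d → ℂ) ρ, ∑ k : Fin n → Fin d,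
          (g (wordCount k) / wordMult (wordCount k)) *
          ((∏ j, conj (w j) ^ wordCount k j) * (∏ j, w j ^ α j) * polyWeight w) := by
          congr 1
          ext w
          rw [hF, hP, hu]
          simp only [multiSeries_apply, Finset.sum_mul]
          exact Finset.sum_congr rfl fun k _ => by ring
      _ = _ := by
          rw [integral_finsetSum _ fun k _ => hterm k]
          refine Finset.sum_congr rfl fun k _ => ?_
          rw [integral_const_mul, setIntegral_polydisc_monomials hρ]
          split_ifs with hk
          · rw [hk]
          · rw [mul_zero]
  -- By orthogonality only the words with letter counts α contribute. They all have length |α|, and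
  -- there are `wordMult α` of them, which cancels the division in the coefficients.
  have h4 : HasSum (fun n => ∫ w in Metric.closedBall (0 : Fin d → ℂ) ρ, F n w) (b α) := by
    have h5 : ∫ w in Metric.closedBall (0 : Fin d → ℂ) ρ, F (∑ j, α j) w = b α := by
      rw [h3, ← Finset.sum_filter, Finset.sum_const]
      change wordMult α • _ = _
      have e1 : (wordMult α : ℂ) ≠ 0 := by exact_mod_cast (wordMult_pos α).ne'
      have e2 : ((∏ j, discMoment ρ (α j) : ℝ) : ℂ) ≠ 0 := by exact_mod_cast (hNpos α).ne'
      rw [nsmul_eq_mul, hg]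
      field_simp
    rw [← h5]
    refine hasSum_single _ fun n hn => ?_
    rw [h3]
    refine Finset.sum_eq_zero fun k _ => if_neg fun hk => hn ?_
    rw [← hk, sum_wordCount]
  rw [h2]
  exact h1.unique h4

end PowerSeries


/-! ### Construction of the function on the polydisc -/

section Polydisc

variable {d : ℕ}

/-- Sequences of geometric growth are moment sequences with respect to `e^{-w²/8 - |w|²/4}`. -/
theorem exists_analytic_twisted_moments {a : (Fin d → ℕ) → ℂ} {C R : ℝ} (hR : 0 < R)
    (ha : ∀ α, ‖a α‖ ≤ C * R ^ (∑ j, α j)) :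
    ∃ (ρ : ℝ) (G : (Fin d → ℂ) → ℂ), 0 < ρ ∧ AnalyticOnNhd ℂ G (Metric.closedBall 0 ρ) ∧
      ∀ α, ∫ w in Metric.closedBall (0 : Fin d → ℂ) ρ, G (fun j => conj (w j)) *
        ((∏ j, w j ^ α j) * Complex.exp (-(∑ j, w j ^ 2) / 8) * polyWeight w) = a α := by
  -- Here a = exp(-T/8) b with T = `shiftSum`. If G has the untwisted moments b, expanding e^{-w²/8}
  -- gives it the twisted moments exp(-T/8) b = a.
  obtain ⟨b, C', hC', hb, hsum⟩ := exists_hasSum_shiftSum hR ha (-1 / 8)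
  obtain ⟨ρ, G, hρ, hG, hmom⟩ := exists_analytic_moments hC' hR hb
  refine ⟨ρ, G, hρ, hG, fun α => ?_⟩
  set K := Metric.closedBall (0 : Fin d → ℂ) ρ with hKdef
  have hK : IsCompact K := isCompact_closedBall _ _
  have hconj : ∀ w ∈ K, (fun j => conj (w j)) ∈ K := fun w hw => by
    rw [hKdef, mem_closedBall_zero_iff, pi_norm_le_iff_of_nonneg hρ.le] at hw ⊢
    simpa using hw
  have hGc : ContinuousOn (fun w : Fin d → ℂ => G (fun j => conj (w j))) K :=
    hG.continuousOn.comp (continuous_pi fun j =>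
      Complex.continuous_conj.comp (continuous_apply j)).continuousOn hconj
  have hW := continuous_polyWeight (d := d)
  have hint : ∀ {q : (Fin d → ℂ) → ℂ}, Continuous q → IntegrableOn
      (fun w => G (fun j => conj (w j)) * (q w * polyWeight w)) K := fun {q} hq =>
    (hGc.mul (hq.mul hW).continuousOn).integrableOn_compact hK
  -- Multiplying the integrand by ∑ w_j² sends the moment of index α to the sum of those of index α
  -- + 2e_j.
  have hpow : ∀ (n : ℕ) (α : Fin d → ℕ), ∫ w in K, G (fun j => conj (w j)) *
      (((∑ j, w j ^ 2) ^ n * ∏ j, w j ^ α j) * polyWeight w) = (shiftSum^[n] b) α := by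
    intro n
    induction n with
    | zero => intro α; simpa using hmom α
    | succ n ih =>
      intro α
      rw [Function.iterate_succ_apply', shiftSum]
      simp only [← ih]
      rw [← integral_finsetSum _ fun j _ => hint (by fun_prop)]
      congr 1
      ext w
      rw [← Finset.mul_sum, ← Finset.sum_mul, ← Finset.mul_sum, pow_succ, mul_assoc ((∑ j, w j ^ 2) ^ n),
        Finset.sum_mul]
      congr 4
      ext j
      have : ∏ i, w i ^ ((α + Pi.single j 2 : Fin d → ℕ) i) =
          (∏ i, w i ^ α i) * ∏ i, w i ^ ((Pi.single j 2 : Fin d → ℕ) i) := by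
        rw [← Finset.prod_mul_distrib]
        simp [pow_add]
      rw [this, mul_comm]
      congr 1
      rw [Finset.prod_eq_single j]
      · simp
      · intro i _ hij
        simp [hij]
      · simp
  obtain ⟨B, hB⟩ := hK.exists_bound_of_continuousOn (f := fun w => G (fun j => conj (w j)) *
    ((∏ j, w j ^ α j) * polyWeight w)) (hGc.mul
      ((by fun_prop : Continuous fun w : Fin d → ℂ => ∏ j, w j ^ α j).mul hW).continuousOn)
  obtain ⟨Q, hQ⟩ := hK.exists_bound_of_continuousOn (f := fun w : Fin d → ℂ => ∑ j, w j ^ 2)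
    (by fun_prop)
  have hQ0 : 0 ≤ Q := (norm_nonneg _).trans (hQ 0 (Metric.mem_closedBall_self hρ.le))
  set F : ℕ → (Fin d → ℂ) → ℂ := fun n w => (-1 / 8 : ℂ) ^ n / (n ! : ℂ) *
    (G (fun j => conj (w j)) * (((∑ j, w j ^ 2) ^ n * ∏ j, w j ^ α j) * polyWeight w)) with hF
  have hFint : ∀ n, IntegrableOn (F n) K := fun n => (hint (by fun_prop)).const_mul _
  have hFle : ∀ n, ∀ w ∈ K, ‖F n w‖ ≤ Q ^ n / (n ! : ℝ) * B := fun n w hw => by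
    have e : F n w = (-1 / 8 : ℂ) ^ n * ((∑ j, w j ^ 2) ^ n / (n ! : ℂ) *
        (G (fun j => conj (w j)) * ((∏ j, w j ^ α j) * polyWeight w))) := by
      rw [hF]; ring
    rw [e, norm_mul, norm_mul, norm_div, Complex.norm_natCast, norm_pow, norm_pow]
    calc _ ≤ 1 * (Q ^ n / (n ! : ℝ) * B) := by
          gcongr
          · exact pow_le_one₀ (norm_nonneg _) (by norm_num)
          · exact hQ w hw
          · exact hB w hw
      _ = _ := one_mul _
  have hsumm : Summable fun n => ∫ w in K, ‖F n w‖ := by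
    refine Summable.of_nonneg_of_le (fun n => integral_nonneg fun _ => norm_nonneg _) (fun n => ?_)
      ((Real.summable_pow_div_factorial Q).mul_right (B * volume.real K))
    refine (setIntegral_mono_on (hFint n).norm (integrableOn_const hK.measure_lt_top.ne)
      Metric.isClosed_closedBall.measurableSet (hFle n)).trans_eq ?_
    rw [setIntegral_const, smul_eq_mul]
    ring
  have h1 := hasSum_integral_of_summable_integral_norm hFint hsumm
  have h2 : ∀ w, ∑' n, F n w = G (fun j => conj (w j)) *
        ((∏ j, w j ^ α j) * Complex.exp (-(∑ j, w j ^ 2) / 8) * polyWeight w) := fun w => by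
    have hexp : HasSum (fun n : ℕ => (-(∑ j, w j ^ 2) / 8) ^ n / (n ! : ℂ))
        (Complex.exp (-(∑ j, w j ^ 2) / 8)) := by
      rw [Complex.exp_eq_exp_ℂ]
      exact NormedSpace.expSeries_div_hasSum_exp _
    have h3 := hexp.mul_left (G (fun j => conj (w j)) * ((∏ j, w j ^ α j) * polyWeight w))
    have e : (fun n => F n w) = fun n : ℕ => G (fun j => conj (w j)) *
        ((∏ j, w j ^ α j) * polyWeight w) * ((-(∑ j, w j ^ 2) / 8) ^ n / (n ! : ℂ)) := by
      ext n
      rw [hF]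
      simp only
      rw [show (-(∑ j, w j ^ 2) / 8 : ℂ) = (-1 / 8) * ∑ j, w j ^ 2 by ring, mul_pow]
      ring
    rw [e, h3.tsum_eq]
    ring
  simp only [h2] at h1
  refine h1.unique ((hsum α).congr_fun fun n => ?_)
  rw [hF]
  simp only
  rw [integral_const_mul, hpow]

/-- The identification `(x, ξ) ↦ x + i ξ`. -/
def complexCoords : (RSp d × RSp d) ≃ᵐ (Fin d → ℂ) :=
  ((MeasurableEquiv.toLp 2 (Fin d → ℝ)).symm.prodCongr (MeasurableEquiv.toLp 2 (Fin d → ℝ)).symm).trans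
    ((MeasurableEquiv.arrowProdEquivProdArrow ℝ ℝ (Fin d)).symm.trans
      (MeasurableEquiv.piCongrRight fun _ => Complex.measurableEquivRealProd.symm))

theorem complexCoords_apply (p : RSp d × RSp d) : complexCoords p = fun j => zCoord j p := by
  ext j
  rw [zCoord_apply]
  apply Complex.ext
  · simp [complexCoords]
    rfl
  · simp [complexCoords]
    rfl

theorem measurePreserving_complexCoords : MeasurePreserving (complexCoords (d := d)) := by
  have h1 := (EuclideanSpace.volume_preserving_symm_measurableEquiv_toLp (Fin d)).prod
    (EuclideanSpace.volume_preserving_symm_measurableEquiv_toLp (Fin d))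
  have h2 := (volume_measurePreserving_arrowProdEquivProdArrow ℝ ℝ (Fin d)).symm
  have h3 := volume_preserving_pi (fun _ : Fin d => Complex.volume_preserving_equiv_real_prod.symm)
  exact h3.comp (h2.comp h1)

/-- The norm on `Fin d → ℂ` is the sup norm, so polydiscs with equal radii are balls. -/
theorem closedPolydisc_const {ρ : ℝ} (hρ : 0 ≤ ρ) :
    closedPolydisc (fun _ : Fin d => ρ) = Metric.closedBall 0 ρ := by
  ext w
  rw [mem_closedBall_zero_iff, pi_norm_le_iff_of_nonneg hρ]
  rfl

theorem isCompact_preimage_polydisc (ρ : ℝ) :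
    IsCompact {p : RSp d × RSp d | ∀ j, ‖zCoord j p‖ ≤ ρ} := by
  refine Metric.isCompact_of_isClosed_isBounded ?_ ?_
  · simp only [Set.ofPred_forall]
    exact isClosed_iInter fun j => isClosed_le (zCoord j).continuous.norm continuous_const
  · refine isBounded_iff_forall_norm_le.2 ⟨∑ _j : Fin d, ρ, fun p hp => ?_⟩
    have hcoord : ∀ x : RSp d, (∀ j, |x j| ≤ ρ) → ‖x‖ ≤ ∑ _j : Fin d, ρ := fun x hx => by
      rw [EuclideanSpace.norm_eq]
      refine (Real.sqrt_le_sqrt (Finset.sum_sq_le_sq_sum_of_nonneg fun j _ => norm_nonneg _)).trans ?_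
      rw [Real.sqrt_sq (Finset.sum_nonneg fun j _ => norm_nonneg _)]
      exact Finset.sum_le_sum fun j _ => hx j
    have hre : ∀ j, |p.1 j| ≤ ρ := fun j => by
      have := (Complex.abs_re_le_norm (zCoord j p)).trans (hp j)
      simpa [zCoord_apply] using this
    have him : ∀ j, |p.2 j| ≤ ρ := fun j => by
      have := (Complex.abs_im_le_norm (zCoord j p)).trans (hp j)
      simpa [zCoord_apply] using this
    exact max_le (hcoord _ hre) (hcoord _ him)

theorem conj_zCoord (j : Fin d) (p : RSp d × RSp d) :
    conj (zCoord j p) = (p.1 j : ℂ) - Complex.I * (p.2 j : ℂ) := by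
  rw [zCoord_apply]
  simp [sub_eq_add_neg]

/-- The exponential factors of `F · conj (V_φ h_α)`, `F = F_0(x - iξ) e^{-i⟨x, ξ⟩} χ_r`. -/
theorem exp_factors_eq (p : RSp d × RSp d) :
    Complex.exp (-(∑ j, conj (zCoord j p) ^ 2) / 8) *
      Complex.exp (-Complex.I * (inner ℝ p.1 p.2 : ℝ)) *
      (positionGaussian p * Complex.exp ((∑ j, zCoord j p ^ 2) / 4)) =
    Complex.exp (-(∑ j, zCoord j p ^ 2) / 8) * polyWeight (fun j => zCoord j p) := by
  rw [polyWeight, ← Complex.ofReal_prod, ← Real.exp_sum, positionGaussian, Complex.ofReal_exp,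
    Complex.ofReal_exp, ← Complex.exp_add, ← Complex.exp_add, ← Complex.exp_add, ← Complex.exp_add]
  congr 1
  have hn : ∀ j, ((‖zCoord j p‖ : ℝ) : ℂ) ^ 2 = (p.1 j : ℂ) ^ 2 + (p.2 j : ℂ) ^ 2 := fun j => by
    rw [← Complex.mul_conj', conj_zCoord, zCoord_apply]
    linear_combination (-(p.2 j : ℂ) ^ 2) * Complex.I_sq
  rw [EuclideanSpace.norm_sq_eq, PiLp.inner_apply]
  simp only [RCLike.inner_apply, conj_trivial, Real.norm_eq_abs, sq_abs]
  push_cast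
  simp only [hn, Finset.mul_sum, Finset.sum_div, ← Finset.sum_neg_distrib, ← Finset.sum_add_distrib]
  refine Finset.sum_congr rfl fun j _ => ?_
  rw [conj_zCoord, zCoord_apply]
  linear_combination ((p.2 j : ℂ) ^ 2 / 4) * Complex.I_sq

/-- The functions in the last condition of the theorem are bounded with compact support. -/
theorem isBoundedCompactlySupported_polydisc {ρ : ℝ} {F₀ : (Fin d → ℂ) → ℂ}
    (hF₀ : ContinuousOn F₀ (closedPolydisc fun _ : Fin d => ρ)) :
    IsBoundedCompactlySupported (fun p : RSp d × RSp d =>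
      F₀ (fun j => (p.1 j : ℂ) - Complex.I * (p.2 j : ℂ)) *
        Complex.exp (-Complex.I * (inner ℝ p.1 p.2 : ℝ)) * polydiscChar (fun _ => ρ) p) := by
  set S := {p : RSp d × RSp d | ∀ j, ‖zCoord j p‖ ≤ ρ} with hS
  have hSc : IsCompact S := isCompact_preimage_polydisc ρ
  set H : RSp d × RSp d → ℂ := fun p => F₀ (fun j => (p.1 j : ℂ) - Complex.I * (p.2 j : ℂ)) *
        Complex.exp (-Complex.I * (inner ℝ p.1 p.2 : ℝ)) with hH
  have hHc : ContinuousOn H S := by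
    refine ContinuousOn.mul (hF₀.comp (f := fun p : RSp d × RSp d => fun j =>
      (p.1 j : ℂ) - Complex.I * (p.2 j : ℂ)) ?_ fun p hp j => ?_) ?_
    · simp only [← conj_zCoord]
      exact (continuous_pi fun j => Complex.continuous_conj.comp (zCoord j).continuous).continuousOn
    · simp only [← conj_zCoord, RCLike.norm_conj]
      exact hp j
    · exact (by fun_prop : Continuous fun p : RSp d × RSp d =>
        Complex.exp (-Complex.I * (inner ℝ p.1 p.2 : ℝ))).continuousOn
  have e : (fun p : RSp d × RSp d => F₀ (fun j => (p.1 j : ℂ) - Complex.I * (p.2 j : ℂ)) *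
        Complex.exp (-Complex.I * (inner ℝ p.1 p.2 : ℝ)) * polydiscChar (fun _ => ρ) p) =
      S.indicator H := by
    ext p
    by_cases hp : p ∈ S
    · rw [Set.indicator_of_mem hp, polydiscChar, Set.indicator_of_mem (by exact hp), mul_one]
    · rw [Set.indicator_of_notMem hp, polydiscChar, Set.indicator_of_notMem (by exact hp), mul_zero]
  rw [e]
  obtain ⟨B, hB⟩ := hSc.exists_bound_of_continuousOn hHc
  constructor
  · refine memLp_top_of_bound ((aestronglyMeasurable_indicator_iff hSc.measurableSet).2
      (hHc.aestronglyMeasurable hSc.measurableSet)) (max B 0) (Filter.Eventually.of_forall fun p => ?_)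
    by_cases hp : p ∈ S
    · rw [Set.indicator_of_mem hp]
      exact (hB p hp).trans (le_max_left _ _)
    · rw [Set.indicator_of_notMem hp, norm_zero]
      exact le_max_right _ _
  · exact HasCompactSupport.intro hSc fun p hp => Set.indicator_of_notMem hp _

theorem exists_polydisc_of_memPilipovicFlat
    {f : Module.Dual ℂ (gelfandShilov (1 / 2) (RSp d))} (hf : MemPilipovicFlat 1 f) :
    ∃ F : RSp d × RSp d → ℂ, IsBoundedCompactlySupported F ∧
        (∃ r : Fin d → ℝ, (∀ j, 0 < r j) ∧
          ∃ F₀ : (Fin d → ℂ) → ℂ, AnalyticOnNhd ℂ F₀ (closedPolydisc r) ∧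
            ∀ x ξ : RSp d, F (x, ξ) =
              F₀ (fun j => (x j : ℂ) - Complex.I * (ξ j : ℂ)) *
                Complex.exp (-Complex.I * (inner ℝ x ξ : ℝ)) * polydiscChar r (x, ξ)) ∧
        IsStftAdjointFun (gaussianWindow d) F f := by
  obtain ⟨f₀, ⟨hf₀, r, hr, C, hC⟩, hff⟩ := hf
  -- The numerator dominates every r_j and is positive even when d = 0. The denominator compensates
  -- the factor 2^{-|α|/2} in `hermiteNorm α`, whose other factor cancels α!^{-1/2}.
  set R : ℝ := (1 + ∑ j, r j) / 2 ^ (-(1 / 2) : ℝ) with hRd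
  have hr0 : 0 ≤ ∑ j, r j := Finset.sum_nonneg fun j _ => (hr j).le
  have hR : 0 < R := by positivity
  have hC0 : 0 ≤ C := by
    have := (norm_nonneg _).trans (hC 0)
    simpa using this
  have ha : ∀ α, ‖hermiteCoeff f₀ α / (hermiteNorm α : ℂ)‖ ≤ C * R ^ (∑ j, α j) := fun α => by
    rw [norm_div, Complex.norm_real, Real.norm_of_nonneg (hermiteNorm_pos α).le,
      div_le_iff₀ (hermiteNorm_pos α), hermiteNorm_eq]
    refine (hC α).trans ?_
    rw [mul_one, mul_assoc C, ← mul_assoc (R ^ _), ← mul_pow, hRd, div_mul_cancel₀ _ (by positivity),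
      ← Finset.prod_pow_eq_pow_sum]
    have hA : 0 ≤ (∏ j, ((α j)! : ℝ)) ^ (-(1 / 2) : ℝ) :=
      Real.rpow_nonneg (Finset.prod_nonneg fun _ _ => by positivity) _
    gcongr with j
    · exact fun j _ => pow_nonneg (hr j).le _
    · exact (hr j).le
    · have := Finset.single_le_sum (f := r) (fun j _ => (hr j).le) (Finset.mem_univ j)
      linarith
  obtain ⟨ρ, G, hρ, hG, hmom⟩ := exists_analytic_twisted_moments hR ha
  -- The product of e^{-i⟨x,ξ⟩} and the exponentials in the transform of h_α is e^{-|z|²/4}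
  -- e^{z̄²/8} e^{-z²/8}. The first factor of F₀, taken at z̄, removes e^{z̄²/8}; the holomorphic
  -- e^{-z²/8} cannot be absorbed into a function of z̄ and is the twist in the moments.
  set F₀ : (Fin d → ℂ) → ℂ := fun w => Complex.exp (-(∑ j, w j ^ 2) / 8) * G w with hF₀
  have hF₀a : AnalyticOnNhd ℂ F₀ (closedPolydisc fun _ => ρ) := by
    rw [closedPolydisc_const hρ.le]
    refine AnalyticOnNhd.mul (fun w _ => ?_) hG
    have : AnalyticAt ℂ (fun w : Fin d → ℂ => -(∑ j, w j ^ 2) / 8) w := by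
      refine AnalyticAt.div_const (AnalyticAt.neg ?_)
      exact Finset.analyticAt_fun_sum _ fun j _ =>
        ((ContinuousLinearMap.proj j : (Fin d → ℂ) →L[ℂ] ℂ).analyticAt w).pow 2
    exact this.cexp
  have hbdd := isBoundedCompactlySupported_polydisc hF₀a.continuousOn
  refine ⟨_, hbdd, ⟨fun _ => ρ, fun _ => hρ, F₀, hF₀a, fun x ξ => rfl⟩, ?_⟩
  refine isStftAdjointFun_of_hermiteCoeff hbdd hf₀ hff fun α => ?_
  have hκ : (hermiteNorm α : ℂ) ≠ 0 := by exact_mod_cast (hermiteNorm_pos α).ne'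
  rw [← (mul_div_cancel₀ (hermiteCoeff f₀ α) hκ : _ = _), ← hmom α, ← integral_const_mul]
  -- The moment integral over the polydisc is pulled back to phase space and written with an
  -- indicator, so that the two integrands can be compared pointwise.
  rw [← (measurePreserving_complexCoords (d := d)).setIntegral_preimage_emb
    complexCoords.measurableEmbedding, ← integral_indicator
    (complexCoords.measurable Metric.isClosed_closedBall.measurableSet)]
  congr 1
  ext p
  by_cases hp : (fun j => zCoord j p) ∈ Metric.closedBall (0 : Fin d → ℂ) ρ
  · rw [Set.indicator_of_mem (by rw [Set.mem_preimage, complexCoords_apply]; exact hp),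
      complexCoords_apply, laplaceTransform_hermiteWindow, polydiscChar, Set.indicator_of_mem
      (by rw [closedPolydisc_const hρ.le]; exact hp)]
    simp only [hF₀, ← conj_zCoord]
    linear_combination (hermiteNorm α * (∏ j, zCoord j p ^ α j) *
      G (fun j => conj (zCoord j p))) * exp_factors_eq p
  · rw [Set.indicator_of_notMem (by rw [Set.mem_preimage, complexCoords_apply]; exact hp),
      polydiscChar, Set.indicator_of_notMem (by rw [closedPolydisc_const hρ.le]; exact hp)]
    simp

end Polydisc

end

theorem mainTheorem10 (d : ℕ) (s : ℝ) (hs : 1 < s)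
    (f : Module.Dual ℂ (gelfandShilov (1 / 2) (RSp d)))
    (hf : f ∈ gelfandShilovDual (1 / 2) (RSp d)) :
    List.TFAE [
      MemPilipovicFlat 1 f,
      ∃ F ∈ gevreyDual s (RSp d × RSp d), IsStftAdjoint (gaussianWindow d) F f,
      ∃ F : RSp d × RSp d → ℂ, IsBoundedCompactlySupported F ∧
        IsStftAdjointFun (gaussianWindow d) F f,
      ∃ F : RSp d × RSp d → ℂ, IsBoundedCompactlySupported F ∧
        (∃ r : Fin d → ℝ, (∀ j, 0 < r j) ∧
          ∃ F₀ : (Fin d → ℂ) → ℂ, AnalyticOnNhd ℂ F₀ (closedPolydisc r) ∧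
            ∀ x ξ : RSp d, F (x, ξ) =
              F₀ (fun j => (x j : ℂ) - Complex.I * (ξ j : ℂ)) *
                Complex.exp (-Complex.I * (inner ℝ x ξ : ℝ)) * polydiscChar r (x, ξ)) ∧
        IsStftAdjointFun (gaussianWindow d) F f] := by
  tfae_have 1 → 4 := exists_polydisc_of_memPilipovicFlat
  tfae_have 4 → 3 := fun ⟨F, hF, _, h⟩ => ⟨F, hF, h⟩
  tfae_have 3 → 2 := fun ⟨_, hF, h⟩ =>
    ⟨functionDual s hF, functionDual_mem s hF, h.isStftAdjoint hs.le hF⟩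
  tfae_have 2 → 1 := fun ⟨_, hF, h⟩ => memPilipovicFlat_of_isStftAdjoint hs.le hF h
  tfae_finish
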